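/- Fix $\delta\ge 1$ and an integer $k\ge1$. All point sets are finite subsets of the strip $\mathbb{R}\times[0,\delta]$; such a set is \emph{sparse} (with sparseness constant $k$) if every rectangle $[x,x+1]\times[0,\delta]$ contains at most $k$ of its points. The \emph{Hanan grid} of a point set $P$ consists of all horizontal and vertical lines through points of $P$. A \emph{rectilinear Steiner tree} on $P$ is a finite tree embedded in the plane that has every point of $P$ as a vertex and whose edges are horizontal or vertical segments overlapping only at their endpoints; only trees contained in the Hanan grid of $P$ are considered, and an \emph{MRST} on $P$ is such a tree of minimum total edge length. If the points $p_1,p_2,\dots$ of $P$ are sorted by their $x$-coordinates $x_1\le x_2\le\cdots$ and $x_i<x_{i+1}$, then the \emph{separator} $s_i$ is the vertical line with $x$-coordinate $(x_i+x_{i+1})/2$, and $X(s_i)$ denotes the set of points where the Hanan grid of $P$ crosses $s_i$. The \emph{crossing pattern} of a tree $T$ at $s_i$ is the partition of the set of points where $T$ crosses $s_i$ in which two points are in the same part if and only if the path in $T$ between them does not go to the right of $s_i$. A partition of a subset of $X(s_i)$ is a \emph{viable crossing pattern} at $s_i$ if it is non-crossing (no two different parts alternate along $s_i$) and the subset has at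 most $(9k+18)(2+\sqrt\delta)$ points. \textbf{Proposition.} For every integer $k\ge 1$ there exist constants $c_1,c_2,C>0$ and a function $f:[1,\infty)\to(0,\infty)$ such that for every $\delta\ge1$ and every integer $n\ge C\sqrt\delta$ there exist a sparse set $P_{\mathrm{left}}$ of $\lfloor n/2\rfloor$ points, a vertical line $s$, and a finite collection $\mathcal P$ of sparse point sets with $$f(\delta)\,n^{c_1\sqrt\delta}\;\le\;|\mathcal P|\;\le\; f(\delta)\,n^{c_2\sqrt\delta}$$ such that the following holds. (1) For every $P\in\mathcal P$: $c_1\sqrt\delta\le|P|\le c_2\sqrt\delta$; the set $P$ lies strictly to the right of $P_{\mathrm{left}}$; the set $P_{\mathrm{left}}\cup P$ is sparse; $s$ is the separator $s_{\lfloor n/2\rfloor}$ of $P_{\mathrm{left}}\cup P$ (the one between $P_{\mathrm{left}}$ and $P$); and the Hanan grid of $P_{\mathrm{left}}\cup P$ crosses $s$ in exactly the points where the Hanan grid of $P_{\mathrm{left}}$ does, so that $X(s)$ is the same for all $P\in\mathcal P$. (2) For every $P\in\mathcal P$ there is an MRST on $P_{\mathrm{left}}\cup P$, all MRSTs on $P_{\mathrm{left}}\cup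 P$ have the same crossing pattern at $s$, and this crossing pattern is viable. (3) The crossing patterns in (2) are different for different $P\in\mathcal P$. Hence the number of viable crossing patterns at $s$ that actually occur is at least $|\mathcal P|=f(\delta)\cdot n^{\Theta(\sqrt\delta)}$. -/

import Mathlib

/-- A rectilinear tree: a finite tree embedded in the plane whose edges are horizontal or vertical
line segments that overlap only at their endpoints. -/
structure RectilinearTree where
  verts : Finset (ℝ × ℝ)
  graph : SimpleGraph verts
  isTree : graph.IsTree
  axisParallel : ∀ u v : verts, graph.Adj u v → u.1.1 = v.1.1 ∨ u.1.2 = v.1.2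
  overlap : ∀ u v u' v' : verts, graph.Adj u v → graph.Adj u' v' → s(u, v) ≠ s(u', v') →
    segment ℝ u.1 v.1 ∩ segment ℝ u'.1 v'.1 ⊆
      ({u.1, v.1} : Set (ℝ × ℝ)) ∩ ({u'.1, v'.1} : Set (ℝ × ℝ))

namespace RectilinearTree

/-- The subset of the plane that is covered by the tree. -/
def carrier (T : RectilinearTree) : Set (ℝ × ℝ) :=
  {q | q ∈ T.verts ∨ ∃ u v : T.verts, T.graph.Adj u v ∧ q ∈ segment ℝ u.1 v.1}

/-- The length of an edge. For axis-parallel edges this is the Euclidean length. -/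
def edgeLength {V : Finset (ℝ × ℝ)} : Sym2 V → ℝ :=
  Sym2.lift ⟨fun u v => |u.1.1 - v.1.1| + |u.1.2 - v.1.2|, fun u v => by
    simp only [abs_sub_comm]⟩

open Classical in
/-- The length of the tree: the sum of the lengths of its edges. -/
noncomputable def length (T : RectilinearTree) : ℝ :=
  ∑ e ∈ T.graph.edgeFinset, edgeLength e

/-- `T` is a rectilinear Steiner tree for the terminal set `P`. -/
def IsSteinerTree (P : Finset (ℝ × ℝ)) (T : RectilinearTree) : Prop :=
  P ⊆ T.verts

end RectilinearTree

/-- The Hanan grid of `P`: all horizontal and vertical lines through at least one point of `P`. -/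
def hananGrid (P : Finset (ℝ × ℝ)) : Set (ℝ × ℝ) :=
  {q | ∃ p ∈ P, q.1 = p.1 ∨ q.2 = p.2}

/-- `T` is a minimum rectilinear Steiner tree on `P`. As usual, rectilinear Steiner trees are
taken to lie on the Hanan grid. -/
def IsMRST (P : Finset (ℝ × ℝ)) (T : RectilinearTree) : Prop :=
  T.IsSteinerTree P ∧ T.carrier ⊆ hananGrid P ∧
    ∀ T' : RectilinearTree, T'.IsSteinerTree P → T'.carrier ⊆ hananGrid P → T.length ≤ T'.length

/-- `P` lies in the strip `ℝ × [0, δ]`. -/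
def InStrip (δ : ℝ) (P : Finset (ℝ × ℝ)) : Prop :=
  ∀ p ∈ P, 0 ≤ p.2 ∧ p.2 ≤ δ

/-- `P` is sparse with sparseness constant `k`: each rectangle `[x, x + 1] × [0, δ]` contains at
most `k` points of `P`. -/
def IsSparse (δ : ℝ) (k : ℕ) (P : Finset (ℝ × ℝ)) : Prop :=
  ∀ x : ℝ, ((P : Set (ℝ × ℝ)) ∩ Set.Icc x (x + 1) ×ˢ Set.Icc 0 δ).ncard ≤ k

open Classical in
/-- The vertical line `x = c` is the separator `s_i` of `P`: if `p_1, p_2, …` are the points of `P`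
sorted by `x`-coordinate, then `x_i < x_{i+1}` and `c = (x_i + x_{i+1}) / 2`. -/
def IsSeparator (P : Finset (ℝ × ℝ)) (i : ℕ) (c : ℝ) : Prop :=
  ∃ a ∈ P, ∃ b ∈ P, a.1 < b.1 ∧ (∀ q ∈ P, q.1 ≤ a.1 ∨ b.1 ≤ q.1) ∧
    (P.filter fun q => q.1 ≤ a.1).card = i ∧ c = (a.1 + b.1) / 2

/-- The points where the Hanan grid of `P` crosses the vertical line `x = c`. -/
def gridCrossings (P : Finset (ℝ × ℝ)) (c : ℝ) : Set (ℝ × ℝ) :=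
  hananGrid P ∩ {q | q.1 = c}

/-- The points where the tree `T` crosses the vertical line `x = c`. -/
def treeCrossings (T : RectilinearTree) (c : ℝ) : Set (ℝ × ℝ) :=
  T.carrier ∩ {q | q.1 = c}

/-- The crossing pattern of `T` at the vertical line `x = c`: the partition of the crossing points
(given as its set of parts) in which two points are in the same part if and only if they are joined
by a path in `T` that does not go to the right of the line. -/
def crossingPattern (T : RectilinearTree) (c : ℝ) : Set (Set (ℝ × ℝ)) :=
  {B | ∃ p ∈ treeCrossings T c,
    B = {q ∈ treeCrossings T c | JoinedIn (T.carrier ∩ {z | z.1 ≤ c}) p q}}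

/-- A partition of a set of points on a vertical line is non-crossing if no two different parts
alternate along the line, i.e. if the parts can be realized by disjoint trees on the left-hand side
of the line. -/
def IsNonCrossing (X : Set (Set (ℝ × ℝ))) : Prop :=
  ∀ B ∈ X, ∀ B' ∈ X, B ≠ B' → ∀ a ∈ B, ∀ b ∈ B', ∀ a' ∈ B, ∀ b' ∈ B',
    ¬ (a.2 < b.2 ∧ b.2 < a'.2 ∧ a'.2 < b'.2)

/-- `X` is a viable crossing pattern at the separator `x = c` of the point set `P`: a non-crossing
partition of a set of at most `(9k + 18)(2 + √δ)` points where the Hanan grid crosses the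
separator. -/
def IsViable (δ : ℝ) (k : ℕ) (P : Finset (ℝ × ℝ)) (c : ℝ) (X : Set (Set (ℝ × ℝ))) : Prop :=
  (∀ B ∈ X, B.Nonempty) ∧ X.PairwiseDisjoint id ∧
    ⋃₀ X ⊆ gridCrossings P c ∧ (⋃₀ X).Finite ∧
    ((⋃₀ X).ncard : ℝ) ≤ (9 * k + 18) * (2 + Real.sqrt δ) ∧ IsNonCrossing X

/-! The point sets force every MRST to behave like a comb. A vertical trunk of length `δ` on the
line x = 0 carries `m` right teeth, with `m` about `√δ / 5` for large `δ`, and they alternate with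
left teeth. The topmost left tooth is prolonged far to the left and continues as a descending
staircase. The left ends and the staircase terminals form the left set; the right ends form `P`.
Each right tooth has `N` candidate heights, and the staircase has a terminal at every one of them.
So all candidate lines already belong to the Hanan grid of the left set, while a monotone staircase
costs only the difference between its ends. Independent choices give `N ^ m` sets `P`. In every MRST
exactly the chosen heights occur on the separator x = 1, all in a single part because the trunk lies
to the left. Patterns are thus told apart by the points they use, and being non-crossing is trivial.

Optimality of the comb comes from integral geometry: the length is the integral of the crossing
numbers over vertical and horizontal lines (`length_eq_integral`). The connection to the staircase
is so long that a short tree is cut once by some vertical line (`optLength_lt_of_no_cut`). The two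
sides of that cut are connected, so each must cross the levels it spans. A vertical line meets the
comb once in each of several disjoint slabs around consecutive teeth. A tree that misses a slab must
double its horizontal crossings on a window of height `e` (`exists_multiple_level_interval`), which
costs more than the miss saves (`IsCut.optLength_le`). The windows need tooth spacing of order `m`,
that is `δ` of order `m ^ 2`; this is where the square root comes from.

A tree of the same length has almost everywhere the crossing numbers of the comb. A vertical edge
right of the trunk would add a crossing (`IsTight.card_lt_crossCount`), so everything there is
horizontal and the crossings at x = 1 are the right teeth (`IsTight.treeCrossings_eq`). -/

open Set MeasureTheory

/-! ### Connectedness of trees, and length as an integral of crossing numbers. -/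

namespace RectilinearTree

theorem edge_subset_carrier (T : RectilinearTree) {u v : T.verts} (h : T.graph.Adj u v) :
    segment ℝ u.1 v.1 ⊆ T.carrier :=
  fun _ hz => Or.inr ⟨u, v, h, hz⟩

theorem verts_subset_carrier (T : RectilinearTree) {z : ℝ × ℝ} (h : z ∈ T.verts) :
    z ∈ T.carrier := Or.inl h

theorem joinedIn_of_walk (T : RectilinearTree) {u v : T.verts} (w : T.graph.Walk u v) :
    JoinedIn T.carrier u.1 v.1 := by
  induction w with
  | nil => exact JoinedIn.refl (T.verts_subset_carrier (Subtype.prop _))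
  | cons h _ ih => exact (JoinedIn.of_segment_subset (T.edge_subset_carrier h)).trans ih

theorem joinedIn_vert (T : RectilinearTree) {z : ℝ × ℝ} (hz : z ∈ T.carrier) :
    ∃ u : T.verts, JoinedIn T.carrier z u.1 := by
  rcases hz with hz | ⟨u, v, h, hz⟩
  · exact ⟨⟨z, hz⟩, JoinedIn.refl (T.verts_subset_carrier hz)⟩
  · refine ⟨u, JoinedIn.of_segment_subset ?_⟩
    exact ((convex_segment (𝕜 := ℝ) u.1 v.1).segment_subset hz
      (left_mem_segment ℝ u.1 v.1)).trans (T.edge_subset_carrier h)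

theorem joinedIn_carrier (T : RectilinearTree) {z w : ℝ × ℝ} (hz : z ∈ T.carrier)
    (hw : w ∈ T.carrier) : JoinedIn T.carrier z w := by
  obtain ⟨u, hu⟩ := T.joinedIn_vert hz
  obtain ⟨v, hv⟩ := T.joinedIn_vert hw
  obtain ⟨p⟩ := T.isTree.connected.preconnected u v
  exact (hu.trans (T.joinedIn_of_walk p)).trans hv.symm

theorem isPreconnected_carrier (T : RectilinearTree) : IsPreconnected T.carrier := by
  rcases T.carrier.eq_empty_or_nonempty with h | ⟨z, hz⟩
  · rw [h]; exact isPreconnected_empty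
  · have : IsPathConnected T.carrier := ⟨z, hz, fun _ hw => T.joinedIn_carrier hz hw⟩
    exact this.isConnected.isPreconnected

/-- The open interval of values that a coordinate takes in the interior of an edge. -/
def coordSpan (π : ℝ × ℝ →ₗ[ℝ] ℝ) {V : Finset (ℝ × ℝ)} : Sym2 V → Set ℝ :=
  Sym2.lift ⟨fun u v => Ioo (min (π u.1) (π v.1)) (max (π u.1) (π v.1)), fun u v => by
    simp only [min_comm, max_comm]⟩

open Classical in
/-- The number of edges of the tree that cross the line on which `π` takes the value `c`. -/
noncomputable def crossCount (T : RectilinearTree) (π : ℝ × ℝ →ₗ[ℝ] ℝ) (c : ℝ) : ℝ :=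
  ∑ e ∈ T.graph.edgeFinset, (coordSpan π e).indicator 1 c

theorem integrable_indicator_Ioo (a b : ℝ) :
    Integrable ((Ioo a b).indicator (1 : ℝ → ℝ)) :=
  (integrableOn_const (by simp)).integrable_indicator measurableSet_Ioo

theorem integral_indicator_Ioo {a b : ℝ} (h : a ≤ b) :
    ∫ c, (Ioo a b).indicator (1 : ℝ → ℝ) c = b - a := by
  rw [integral_indicator measurableSet_Ioo]
  simp [Measure.real, h]

theorem integrable_coordSpan (π : ℝ × ℝ →ₗ[ℝ] ℝ) {V : Finset (ℝ × ℝ)} (e : Sym2 V) :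
    Integrable ((coordSpan π e).indicator (1 : ℝ → ℝ)) := by
  induction e using Sym2.ind with
  | _ u v => exact integrable_indicator_Ioo _ _

theorem integrable_crossCount (T : RectilinearTree) (π : ℝ × ℝ →ₗ[ℝ] ℝ) :
    Integrable (T.crossCount π) :=
  integrable_finsetSum _ fun e _ => integrable_coordSpan π e

/-- A Cauchy–Crofton formula: each edge contributes the lengths of its two projections, one of which
is zero for an axis-parallel edge. -/
theorem length_eq_integral (T : RectilinearTree) :
    T.length = (∫ c, T.crossCount (LinearMap.fst ℝ ℝ ℝ) c) +
      ∫ c, T.crossCount (LinearMap.snd ℝ ℝ ℝ) c := by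
  classical
  unfold crossCount length
  rw [integral_finsetSum _ fun e _ => integrable_coordSpan _ e,
    integral_finsetSum _ fun e _ => integrable_coordSpan _ e, ← Finset.sum_add_distrib]
  refine Finset.sum_congr rfl fun e _ => ?_
  induction e using Sym2.ind with
  | _ u v =>
    simp only [coordSpan, edgeLength, Sym2.lift_mk]
    rw [integral_indicator_Ioo min_le_max, integral_indicator_Ioo min_le_max]
    simp [max_sub_min_eq_abs, abs_sub_comm]

theorem eq_of_mem_segment (π : ℝ × ℝ →ₗ[ℝ] ℝ) {u v z w : ℝ × ℝ} (h : π u ≠ π v)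
    (hz : z ∈ segment ℝ u v) (hw : w ∈ segment ℝ u v) (hzw : π z = π w) : z = w := by
  rw [segment_eq_image'] at hz hw
  obtain ⟨a, -, rfl⟩ := hz
  obtain ⟨b, -, rfl⟩ := hw
  simp only [map_add, map_smul, map_sub, smul_eq_mul, add_right_inj] at hzw
  rw [mul_right_cancel₀ (sub_ne_zero.2 h.symm) hzw]

theorem mem_Ioo_of_mem_segment (π : ℝ × ℝ →ₗ[ℝ] ℝ) {u v z : ℝ × ℝ}
    (hz : z ∈ segment ℝ u v) (hu : π z ≠ π u) (hv : π z ≠ π v) :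
    π z ∈ Ioo (min (π u) (π v)) (max (π u) (π v)) := by
  have h : π z ∈ segment ℝ (π u) (π v) := by
    have := mem_image_of_mem π hz
    rwa [← LinearMap.coe_toAffineMap, image_segment] at this
  rw [segment_eq_uIcc, uIcc, mem_Icc] at h
  constructor
  · refine lt_of_le_of_ne h.1 fun h' => ?_
    rcases min_choice (π u) (π v) with h2 | h2 <;> rw [h2] at h' <;> simp_all
  · refine lt_of_le_of_ne h.2 fun h' => ?_
    rcases max_choice (π u) (π v) with h2 | h2 <;> rw [h2] at h' <;> simp_all

/-- A value is generic for a coordinate if no vertex has it. -/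
def IsGeneric (T : RectilinearTree) (π : ℝ × ℝ →ₗ[ℝ] ℝ) (c : ℝ) : Prop :=
  ∀ z ∈ T.verts, π z ≠ c

theorem ae_isGeneric (T : RectilinearTree) (π : ℝ × ℝ →ₗ[ℝ] ℝ) : ∀ᵐ c, T.IsGeneric π c := by
  have : (π '' (T.verts : Set (ℝ × ℝ))).Finite := T.verts.finite_toSet.image _
  filter_upwards [(this.countable.ae_notMem volume)] with c hc z hz h
  exact hc ⟨z, hz, h⟩

theorem exists_edge_of_isGeneric {T : RectilinearTree} {π : ℝ × ℝ →ₗ[ℝ] ℝ} {c : ℝ}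
    (hc : T.IsGeneric π c) {z : ℝ × ℝ} (hz : z ∈ T.carrier) (hzc : π z = c) :
    ∃ u v : T.verts, T.graph.Adj u v ∧ z ∈ segment ℝ u.1 v.1 ∧ c ∈ coordSpan π s(u, v) := by
  rcases hz with hz | ⟨u, v, h, hz⟩
  · exact absurd hzc (hc z hz)
  · refine ⟨u, v, h, hz, ?_⟩
    have := mem_Ioo_of_mem_segment π hz (by rw [hzc]; exact (hc _ u.2).symm)
      (by rw [hzc]; exact (hc _ v.2).symm)
    rw [hzc] at this
    exact this

/-- At a generic value every point lies inside an edge on which `π` is not constant. Such an edge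
takes the value only once, so sending points to edges is injective. -/
theorem card_le_crossCount {T : RectilinearTree} {π : ℝ × ℝ →ₗ[ℝ] ℝ} {c : ℝ}
    (hc : T.IsGeneric π c) (S : Finset (ℝ × ℝ)) (hS : ∀ z ∈ S, z ∈ T.carrier ∧ π z = c) :
    (S.card : ℝ) ≤ T.crossCount π c := by
  classical
  have h1 : T.crossCount π c = ((T.graph.edgeFinset.filter fun e => c ∈ coordSpan π e).card : ℝ) := by
    simp [crossCount, indicator_apply, Finset.sum_boole]
  rw [h1]
  norm_cast
  have h2 : ∀ z ∈ S, ∃ e : Sym2 T.verts, e ∈ T.graph.edgeFinset ∧ c ∈ coordSpan π e ∧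
      ∃ u v, e = s(u, v) ∧ z ∈ segment ℝ u.1 v.1 := by
    intro z hz
    obtain ⟨u, v, h, hz', hc'⟩ := exists_edge_of_isGeneric hc (hS z hz).1 (hS z hz).2
    exact ⟨s(u, v), by simpa using h, hc', u, v, rfl, hz'⟩
  rcases S.eq_empty_or_nonempty with rfl | ⟨z₀, hz₀⟩
  · simp
  have : Nonempty (Sym2 T.verts) := ⟨(h2 z₀ hz₀).choose⟩
  choose! f hf1 hf2 hf3 using h2
  refine Finset.card_le_card_of_injOn f (fun z hz => Finset.mem_filter.2 ⟨hf1 z hz, hf2 z hz⟩) ?_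
  intro z hz w hw hzw
  obtain ⟨u, v, he, hz'⟩ := hf3 z hz
  obtain ⟨u', v', he', hw'⟩ := hf3 w hw
  have hw2 : w ∈ segment ℝ u.1 v.1 := by
    have : s(u, v) = s(u', v') := by rw [← he, ← he']; exact hzw
    rcases Sym2.eq_iff.1 this with ⟨rfl, rfl⟩ | ⟨rfl, rfl⟩
    · exact hw'
    · rwa [segment_symm]
  refine eq_of_mem_segment π (fun h => ?_) hz' hw2 ((hS z hz).2.trans (hS w hw).2.symm)
  have := hf2 z hz
  rw [he] at this
  simp [coordSpan, h] at this

end RectilinearTree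

/-! ### Crossing lemmas for connected sets with levels that are met at most once. -/

/-- Collapsing everything below the level to the only point on it is a continuous retraction of `K`
onto the upper part. If the level is missed, `K` lies on one side by the intermediate value theorem.
-/
theorem IsPreconnected.inter_superlevel {X : Type*} [TopologicalSpace X] {K : Set X}
    (hK : IsPreconnected K) {f : X → ℝ} (hf : Continuous f) {c : ℝ}
    (hs : (K ∩ {z | f z = c}).Subsingleton) : IsPreconnected (K ∩ {z | c ≤ f z}) := by
  classical
  rcases (K ∩ {z | f z = c}).eq_empty_or_nonempty with h | ⟨t, htK, ht⟩
  · rcases (K ∩ {z | c ≤ f z}).eq_empty_or_nonempty with h2 | ⟨a, haK, ha⟩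
    · rw [h2]; exact isPreconnected_empty
    · have : K ∩ {z | c ≤ f z} = K := by
        refine inter_eq_left.2 fun b hb => ?_
        by_contra hbc
        obtain ⟨z, hz, hzc⟩ := hK.intermediate_value hb haK hf.continuousOn
          (show c ∈ Icc (f b) (f a) from ⟨(not_le.1 hbc).le, ha⟩)
        exact (h ▸ (⟨hz, hzc⟩ : z ∈ K ∩ {z | f z = c}) : z ∈ (∅ : Set X))
      rwa [this]
  · have hr : ContinuousOn (fun z => if c ≤ f z then z else t) K := by
      refine ContinuousOn.if ?_ ?_ ?_
      · rintro a ⟨haK, ha⟩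
        have h1 : f a = c := (frontier_le_subset_eq continuous_const hf ha).symm
        exact hs ⟨haK, h1⟩ ⟨htK, ht⟩
      · exact continuousOn_id
      · exact continuousOn_const
    have := hK.image _ hr
    convert this using 1
    ext z
    constructor
    · rintro ⟨hz, hzc⟩
      exact ⟨z, hz, if_pos hzc⟩
    · rintro ⟨w, hw, rfl⟩
      by_cases h : c ≤ f w
      · simp only [h, if_true]; exact ⟨hw, h⟩
      · simp only [h, if_false]; exact ⟨htK, (show f t = c from ht).ge⟩

theorem IsPreconnected.inter_sublevel {X : Type*} [TopologicalSpace X] {K : Set X}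
    (hK : IsPreconnected K) {f : X → ℝ} (hf : Continuous f) {c : ℝ}
    (hs : (K ∩ {z | f z = c}).Subsingleton) : IsPreconnected (K ∩ {z | f z ≤ c}) := by
  have := hK.inter_superlevel hf.neg (c := -c) (by simpa using hs)
  simpa using this

/-- Intermediate value theorem for `min f g`: leaving the quadrant where both are positive means
meeting its boundary. -/
theorem IsPreconnected.exists_corner {X : Type*} [TopologicalSpace X] {K : Set X}
    (hK : IsPreconnected K) {f g : X → ℝ} (hf : Continuous f) (hg : Continuous g) {a b : X}
    (ha : a ∈ K) (hb : b ∈ K) (hfa : 0 < f a) (hga : 0 < g a) (hfb : f b ≤ 0 ∨ g b ≤ 0) :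
    ∃ z ∈ K, 0 ≤ f z ∧ 0 ≤ g z ∧ (f z = 0 ∨ g z = 0) := by
  obtain ⟨z, hz, hz0⟩ := hK.intermediate_value hb ha (hf.min hg).continuousOn
    (show (0 : ℝ) ∈ Icc (min (f b) (g b)) (min (f a) (g a)) from
      ⟨min_le_iff.2 hfb, (lt_min hfa hga).le⟩)
  have hz0 : min (f z) (g z) = 0 := hz0
  refine ⟨z, hz, hz0 ▸ min_le_left _ _, hz0 ▸ min_le_right _ _, ?_⟩
  rcases min_choice (f z) (g z) with h | h
  · exact Or.inl (h ▸ hz0)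
  · exact Or.inr (h ▸ hz0)

/-- Leave the quadrant of `a` and the quadrant of `b`. If neither exit is on `f = 0`, both are on `g
= 0`, hence coincide, and this common point has `f ≥ 0` and `f ≤ 0`. -/
theorem IsPreconnected.exists_zero_of_subsingleton {X : Type*} [TopologicalSpace X] {K : Set X}
    (hK : IsPreconnected K) {f g : X → ℝ} (hf : Continuous f) (hg : Continuous g) {a b : X}
    (ha : a ∈ K) (hb : b ∈ K) (hfa : 0 < f a) (hga : 0 < g a) (hfb : f b < 0) (hgb : 0 < g b)
    (hs : (K ∩ {z | g z = 0}).Subsingleton) : ∃ z ∈ K, f z = 0 ∧ 0 ≤ g z := by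
  obtain ⟨z, hz, h1, h2, h3⟩ := hK.exists_corner hf hg ha hb hfa hga (Or.inl hfb.le)
  obtain ⟨w, hw, h4, h5, h6⟩ := hK.exists_corner hf.neg hg hb ha (by simpa using hfb) hgb
    (Or.inl (by simpa using hfa.le))
  simp only [Pi.neg_apply, neg_nonneg, neg_eq_zero] at h4 h6
  rcases h3 with h3 | h3
  · exact ⟨z, hz, h3, h2⟩
  rcases h6 with h6 | h6
  · exact ⟨w, hw, h6, h5⟩
  obtain rfl := hs ⟨hz, h3⟩ ⟨hw, h6⟩
  exact ⟨z, hz, le_antisymm h4 h1, h2⟩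

/-- The point `t` of `K` at the middle level differs in the sign of `f` from `u` or from `v`, unless
`f t = 0`. The part of `K` on that side of the middle level is still connected, and the outer level
confines the zero of `f`. -/
theorem exists_crossing_of_levels_aux {K : Set (ℝ × ℝ)} (hK : IsPreconnected K) {f : ℝ × ℝ → ℝ}
    (hf : Continuous f) {u v : ℝ × ℝ} (hu : u ∈ K) (hv : v ∈ K) (hfu : f u < 0) (hfv : 0 < f v)
    {y₀ y₁ y₂ : ℝ} (h0 : y₀ < u.2) (h1 : u.2 < y₁) (h2 : y₁ < v.2) (h3 : v.2 < y₂)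
    (hs0 : (K ∩ {z | z.2 = y₀}).Subsingleton) (hs1 : (K ∩ {z | z.2 = y₁}).Subsingleton)
    (hs2 : (K ∩ {z | z.2 = y₂}).Subsingleton) :
    ∃ z ∈ K, f z = 0 ∧ y₀ ≤ z.2 ∧ z.2 ≤ y₂ := by
  obtain ⟨t, ht, hty⟩ := hK.intermediate_value hu hv continuous_snd.continuousOn
    (show y₁ ∈ Icc u.2 v.2 from ⟨h1.le, h2.le⟩)
  rcases lt_trichotomy (f t) 0 with hft | hft | hft
  · obtain ⟨z, hz, hz0, hzg⟩ := (hK.inter_superlevel continuous_snd hs1).exists_zero_of_subsingleton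
      hf (g := fun z => y₂ - z.2) (by fun_prop) (a := v) (b := t) ⟨hv, h2.le⟩ ⟨ht, hty.ge⟩ hfv
      (by simpa using h3) hft (by simp [hty]; linarith)
      (hs2.anti fun z hz => ⟨hz.1.1, (sub_eq_zero.1 hz.2).symm⟩)
    have : y₁ ≤ z.2 := hz.2
    exact ⟨z, hz.1, hz0, by linarith, by linarith⟩
  · exact ⟨t, ht, hft, by linarith, by linarith⟩
  · obtain ⟨z, hz, hz0, hzg⟩ := (hK.inter_sublevel continuous_snd hs1).exists_zero_of_subsingleton
      hf (g := fun z => z.2 - y₀) (by fun_prop) (a := t) (b := u) ⟨ht, hty.le⟩ ⟨hu, h1.le⟩ hft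
      (by simp [hty]; linarith) hfu (by simpa using h0)
      (hs0.anti fun z hz => ⟨hz.1.1, sub_eq_zero.1 hz.2⟩)
    have : z.2 ≤ y₁ := hz.2
    exact ⟨z, hz.1, hz0, by linarith, by linarith⟩

theorem exists_crossing_of_levels {K : Set (ℝ × ℝ)} (hK : IsPreconnected K) {c : ℝ}
    {u v : ℝ × ℝ} (hu : u ∈ K) (hv : v ∈ K) (hc : u.1 < c ∧ c < v.1 ∨ v.1 < c ∧ c < u.1)
    {y₀ y₁ y₂ : ℝ} (h0 : y₀ < u.2) (h1 : u.2 < y₁) (h2 : y₁ < v.2) (h3 : v.2 < y₂)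
    (hs0 : (K ∩ {z | z.2 = y₀}).Subsingleton) (hs1 : (K ∩ {z | z.2 = y₁}).Subsingleton)
    (hs2 : (K ∩ {z | z.2 = y₂}).Subsingleton) :
    ∃ z ∈ K, z.1 = c ∧ y₀ ≤ z.2 ∧ z.2 ≤ y₂ := by
  rcases hc with hc | hc
  · obtain ⟨z, hz, h, h'⟩ := exists_crossing_of_levels_aux hK (f := fun z => z.1 - c)
      (by fun_prop) hu hv (by simpa using hc.1) (by simpa using hc.2) h0 h1 h2 h3 hs0 hs1 hs2
    exact ⟨z, hz, by linarith, h'⟩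
  · obtain ⟨z, hz, h, h'⟩ := exists_crossing_of_levels_aux hK (f := fun z => c - z.1)
      (by fun_prop) hu hv (by simpa using hc.2) (by simpa using hc.1) h0 h1 h2 h3 hs0 hs1 hs2
    exact ⟨z, hz, by linarith, h'⟩

/-- The horizontal coordinate. -/
abbrev xCoord : ℝ × ℝ →ₗ[ℝ] ℝ := LinearMap.fst ℝ ℝ ℝ

/-- The vertical coordinate. -/
abbrev yCoord : ℝ × ℝ →ₗ[ℝ] ℝ := LinearMap.snd ℝ ℝ ℝ

theorem exists_multiple_level_interval {K : Set (ℝ × ℝ)} (hK : IsPreconnected K) {c e : ℝ}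
    {u v : ℝ × ℝ} (hu : u ∈ K) (hv : v ∈ K) (hc : u.1 < c ∧ c < v.1 ∨ v.1 < c ∧ c < u.1)
    (he : 0 < e) (huv : u.2 + e ≤ v.2)
    (hno : ∀ z ∈ K, z.1 = c → z.2 ∉ Icc (u.2 - e) (v.2 + e)) :
    ∃ a, Ioo a (a + e) ⊆ Icc (u.2 - e) (v.2 + e) ∧
      ∀ y ∈ Ioo a (a + e), ¬ (K ∩ {z | z.2 = y}).Subsingleton := by
  -- The candidate windows lie just below `u`, just above `u` and just above `v`. A level met at
  -- most once in each of them would force a crossing with x = c.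
  by_contra! hcon
  obtain ⟨y₀, hy₀, hs₀⟩ := hcon (u.2 - e) (fun y hy => ⟨hy.1.le, by linarith [hy.2]⟩)
  obtain ⟨y₁, hy₁, hs₁⟩ := hcon u.2 (fun y hy => ⟨by linarith [hy.1], by linarith [hy.2]⟩)
  obtain ⟨y₂, hy₂, hs₂⟩ := hcon v.2 (fun y hy => ⟨by linarith [hy.1], by linarith [hy.2]⟩)
  obtain ⟨z, hz, hzc, h1, h2⟩ := exists_crossing_of_levels hK hu hv hc
    (by linarith [hy₀.2]) hy₁.1 (by linarith [hy₁.2]) hy₂.1 hs₀ hs₁ hs₂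
  exact hno z hz hzc ⟨by linarith [hy₀.1], by linarith [hy₂.2]⟩

/-! ### From local surplus crossings to global counts. -/

theorem integral_add_card_le {F B : ℝ → ℝ} (hF : Integrable F) (hB : Integrable B)
    {s : Finset ℕ} {a : ℕ → ℝ} {e : ℝ} (he : 0 ≤ e)
    (hd : (s : Set ℕ).PairwiseDisjoint fun j => Ioo (a j) (a j + e))
    (h1 : ∀ᵐ c, B c ≤ F c) (h2 : ∀ᵐ c, ∀ j ∈ s, c ∈ Ioo (a j) (a j + e) → B c + 1 ≤ F c) :
    (∫ c, B c) + e * s.card ≤ ∫ c, F c := by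
  have hi : Integrable fun c => ∑ j ∈ s, (Ioo (a j) (a j + e)).indicator (1 : ℝ → ℝ) c :=
    integrable_finsetSum _ fun j _ => RectilinearTree.integrable_indicator_Ioo _ _
  have h3 : (∫ c, B c) + e * s.card =
      ∫ c, (B c + ∑ j ∈ s, (Ioo (a j) (a j + e)).indicator (1 : ℝ → ℝ) c) := by
    rw [integral_add hB hi, integral_finsetSum _
      fun j _ => RectilinearTree.integrable_indicator_Ioo _ _]
    simp_rw [RectilinearTree.integral_indicator_Ioo (le_add_of_nonneg_right he)]
    simp [mul_comm]
  rw [h3]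
  refine integral_mono_ae (hB.add hi) hF ?_
  filter_upwards [h1, h2] with c hc1 hc2
  by_cases hc : ∃ j ∈ s, c ∈ Ioo (a j) (a j + e)
  · obtain ⟨j, hj, hcj⟩ := hc
    rw [Finset.sum_eq_single_of_mem j hj, indicator_of_mem hcj]
    · exact hc2 j hj hcj
    · intro i hi hij
      exact indicator_of_notMem (fun h => (hd hi hj hij).le_bot ⟨h, hcj⟩) _
  · push Not at hc
    rw [Finset.sum_eq_zero fun j hj => indicator_of_notMem (hc j hj) _]
    simpa using hc1

namespace RectilinearTree

theorem card_le_crossCount_of_slabs {T : RectilinearTree} {c : ℝ} (hc : T.IsGeneric xCoord c)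
    (s : Finset ℕ) (I : ℕ → Set ℝ) (hI : (s : Set ℕ).PairwiseDisjoint I)
    (h : ∀ j ∈ s, ∃ z ∈ T.carrier, z.1 = c ∧ z.2 ∈ I j) : (s.card : ℝ) ≤ T.crossCount xCoord c := by
  classical
  choose! z hz1 hz2 hz3 using h
  have : (s.image z).card = s.card := Finset.card_image_of_injOn fun i hi j hj hij => by
    by_contra hne
    refine (hI hi hj hne).le_bot ⟨hz3 i hi, ?_⟩
    rw [hij]; exact hz3 j hj
  rw [← this]
  refine card_le_crossCount hc _ fun w hw => ?_
  obtain ⟨j, hj, rfl⟩ := Finset.mem_image.1 hw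
  exact ⟨hz1 j hj, hz2 j hj⟩

/-- Crossings on the two sides of a vertical line add up. A shared point would lie inside a vertical
edge on x = c, which genericity of `c` excludes. -/
theorem card_add_card_le_crossCount {T : RectilinearTree} {c y : ℝ} (hc : T.IsGeneric xCoord c)
    (hy : T.IsGeneric yCoord y) (A B : Finset (ℝ × ℝ))
    (hA : ∀ z ∈ A, z ∈ T.carrier ∧ z.2 = y ∧ z.1 ≤ c)
    (hB : ∀ z ∈ B, z ∈ T.carrier ∧ z.2 = y ∧ c ≤ z.1) :
    (A.card : ℝ) + B.card ≤ T.crossCount yCoord y := by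
  classical
  have hd : Disjoint A B := Finset.disjoint_left.2 fun z hzA hzB => by
    obtain ⟨h1, h2, h3⟩ := hA z hzA
    have h4 : z.1 = c := le_antisymm h3 (hB z hzB).2.2
    obtain ⟨u, v, huv, hz, hs⟩ := exists_edge_of_isGeneric hy h1 h2
    rcases T.axisParallel u v huv with h | h
    · have hz' : z.1 ∈ segment ℝ u.1.1 v.1.1 := by
        have := mem_image_of_mem xCoord hz
        rwa [← LinearMap.coe_toAffineMap, image_segment] at this
      rw [← h, segment_same, mem_singleton_iff] at hz'
      exact hc _ u.2 (hz'.symm.trans h4)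
    · simp [coordSpan, h] at hs
  rw [← Nat.cast_add, ← Finset.card_union_of_disjoint hd]
  refine card_le_crossCount hy _ fun z hz => ?_
  rcases Finset.mem_union.1 hz with hz | hz
  · exact ⟨(hA z hz).1, (hA z hz).2.1⟩
  · exact ⟨(hB z hz).1, (hB z hz).2.1⟩

end RectilinearTree

/-! ### Combs, their length and their crossing numbers. -/

/-- The data of a comb: a vertical trunk of length `g * m` with alternating teeth, where the tooth
at the top of the trunk extends to the left and ends in a descending staircase. -/
structure Comb where
  m : ℕ
  g : ℝ
  M : ℝ
  X : ℝ
  h : ℝ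
  e : ℝ
  y : ℕ → ℝ
  one_le_m : 1 ≤ m
  lower : ∀ j < m, g * j < y j
  upper : ∀ j < m, y j < g * (j + 1)
  -- A missed tooth saves at most `2 * m`. Windows of missed left and right teeth may overlap, so
  -- only half of `e` per miss can be charged.
  e_gt : 4 * m < e
  -- Room for disjoint slabs widened by `e`. With a single right tooth there is nothing to separate,
  -- which covers small `δ`.
  gap : m = 1 ∨ ∀ j < m, g * j + 2 * e < y j ∧ y j + 2 * e < g * (j + 1)
  h_nonneg : 0 ≤ h
  h_le : h ≤ g * m
  X_le : X ≤ -M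
  -- Bounds the trunk, the teeth and the height of the staircase together, so doubling the long
  -- connection never pays off.
  M_gt : 2 * (g * m) + 2 * (m * (m + 1)) < M

namespace Comb

variable (C : Comb)

/-- The end of a left tooth. -/
def q (j : ℕ) : ℝ × ℝ := (-(2 * j), C.g * j)

/-- The end of a right tooth. -/
def p (j : ℕ) : ℝ × ℝ := (2 * (j + 1), C.y j)

/-- The length of the comb together with its staircase. -/
noncomputable def optLength : ℝ :=
  (-(2 * C.m) - C.X) + 2 * (C.m * (C.m + 1)) + (C.g * C.m - C.h) + C.g * C.m

/-- The set contains the ends of all teeth and both ends of the staircase. -/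
structure Spans (K : Set (ℝ × ℝ)) : Prop where
  q_mem : ∀ j ≤ C.m, C.q j ∈ K
  p_mem : ∀ j < C.m, C.p j ∈ K
  low_mem : (C.X, C.h) ∈ K
  high_mem : (-C.M, C.g * C.m) ∈ K

/-- The number of crossings of the comb with a horizontal line. -/
noncomputable def yBase (c : ℝ) : ℝ :=
  (Ioo C.h (C.g * C.m)).indicator 1 c + (Ioo 0 (C.g * C.m)).indicator 1 c

theorem g_pos : 0 < C.g := by
  have h1 := C.lower 0 C.one_le_m
  have h2 := C.upper 0 C.one_le_m
  simp at h1 h2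
  linarith

theorem one_le_m' : (1 : ℝ) ≤ C.m := by exact_mod_cast C.one_le_m

theorem height_pos : 0 < C.g * C.m := mul_pos C.g_pos (by linarith [C.one_le_m'])

theorem two_m_lt_M : 2 * (C.m : ℝ) < C.M := by
  nlinarith [C.M_gt, C.height_pos, C.one_le_m']

theorem X_lt : C.X < -(2 * C.m) := by linarith [C.X_le, C.two_m_lt_M]

theorem e_pos : 0 < C.e := by linarith [C.e_gt, C.one_le_m']

theorem sum_two_mul_succ (m : ℕ) : ∑ j ∈ Finset.range m, (2 * ((j : ℝ) + 1)) = m * (m + 1) := by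
  induction m with
  | zero => simp
  | succ n ih => rw [Finset.sum_range_succ, ih]; push_cast; ring

open RectilinearTree in
theorem integrable_yBase : Integrable C.yBase :=
  (integrable_indicator_Ioo _ _).add (integrable_indicator_Ioo _ _)

open RectilinearTree in
theorem integral_yBase : ∫ c, C.yBase c = (C.g * C.m - C.h) + C.g * C.m := by
  unfold yBase
  rw [integral_add (integrable_indicator_Ioo _ _) (integrable_indicator_Ioo _ _),
    integral_indicator_Ioo C.h_le, integral_indicator_Ioo C.height_pos.le, sub_zero]

/-- The number of crossings of a partial comb with a vertical line. -/
noncomputable def xPart (s t : Finset ℕ) (c : ℝ) : ℝ :=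
  (Ioo C.X (-(2 * C.m))).indicator 1 c +
    ∑ j ∈ s, (Ioo (-(2 * ((j : ℝ) + 1))) 0).indicator 1 c +
    ∑ j ∈ t, (Ioo 0 (2 * ((j : ℝ) + 1))).indicator 1 c

open RectilinearTree in
theorem integrable_xPart (s t : Finset ℕ) : Integrable (C.xPart s t) :=
  ((integrable_indicator_Ioo _ _).add
    (integrable_finsetSum _ fun _ _ => integrable_indicator_Ioo _ _)).add
    (integrable_finsetSum _ fun _ _ => integrable_indicator_Ioo _ _)

open RectilinearTree in
theorem integral_xPart (s t : Finset ℕ) : ∫ c, C.xPart s t c =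
    (-(2 * C.m) - C.X) + ∑ j ∈ s, (2 * ((j : ℝ) + 1)) + ∑ j ∈ t, (2 * ((j : ℝ) + 1)) := by
  unfold xPart
  have h1 : ∀ j : ℕ, (0 : ℝ) ≤ 2 * ((j : ℝ) + 1) := fun j => by positivity
  have hs : Integrable fun c => ∑ j ∈ s, (Ioo (-(2 * ((j : ℝ) + 1))) 0).indicator (1 : ℝ → ℝ) c :=
    integrable_finsetSum _ fun _ _ => integrable_indicator_Ioo _ _
  have ht : Integrable fun c => ∑ j ∈ t, (Ioo 0 (2 * ((j : ℝ) + 1))).indicator (1 : ℝ → ℝ) c :=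
    integrable_finsetSum _ fun _ _ => integrable_indicator_Ioo _ _
  have h0 : Integrable fun c => (Ioo C.X (-(2 * C.m))).indicator (1 : ℝ → ℝ) c +
      ∑ j ∈ s, (Ioo (-(2 * ((j : ℝ) + 1))) 0).indicator (1 : ℝ → ℝ) c :=
    (integrable_indicator_Ioo _ _).add hs
  rw [integral_add h0 ht,
    integral_add (integrable_indicator_Ioo _ _) hs,
    integral_finsetSum _ fun _ _ => integrable_indicator_Ioo _ _,
    integral_finsetSum _ fun _ _ => integrable_indicator_Ioo _ _,
    integral_indicator_Ioo C.X_lt.le]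
  congr 1
  · congr 1
    exact Finset.sum_congr rfl fun j _ => by
      rw [integral_indicator_Ioo (by linarith [h1 j])]; ring
  · exact Finset.sum_congr rfl fun j _ => by
      rw [integral_indicator_Ioo (h1 j)]; ring

/-- The number of crossings of the comb with a vertical line. -/
noncomputable def xBase (c : ℝ) : ℝ :=
  C.xPart (Finset.range C.m) (Finset.range C.m) c

theorem integrable_xBase : Integrable C.xBase := C.integrable_xPart _ _

theorem optLength_eq : C.optLength = (∫ c, C.xBase c) + ∫ c, C.yBase c := by
  unfold xBase
  rw [integral_xPart, integral_yBase, sum_two_mul_succ, optLength]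
  ring

end Comb

/-! ### The comb length as a lower bound. -/

namespace Comb

variable (C : Comb)

/-- The heights around a left tooth and the right tooth above it. -/
noncomputable def lowSlab (j : ℕ) : Set ℝ :=
  -- For `m = 1` there is only one slab, so disjointness is vacuous and plain connectedness yields a
  -- crossing.
  if C.m = 1 then univ else Icc (C.g * j - C.e) (C.y j + C.e)

/-- The heights around a right tooth and the left tooth above it. -/
noncomputable def upSlab (j : ℕ) : Set ℝ :=
  if C.m = 1 then univ else Icc (C.y j - C.e) (C.g * (j + 1) + C.e)

theorem g_mul_le {i j : ℕ} (h : i < j) : C.g * ((i : ℝ) + 1) ≤ C.g * j := by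
  have : (i : ℝ) + 1 ≤ j := by exact_mod_cast h
  exact mul_le_mul_of_nonneg_left this C.g_pos.le

theorem pairwiseDisjoint_of_lt {s : Set ℕ} {I : ℕ → Set ℝ}
    (h : ∀ i ∈ s, ∀ j ∈ s, i < j → Disjoint (I i) (I j)) : s.PairwiseDisjoint I := by
  intro i hi j hj hij
  rcases lt_or_gt_of_ne hij with h' | h'
  · exact h i hi j hj h'
  · exact (h j hj i hi h').symm

theorem lowSlab_disjoint : {j | j < C.m}.PairwiseDisjoint C.lowSlab := by
  refine pairwiseDisjoint_of_lt fun i hi j hj hij => ?_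
  simp only [mem_ofPred_eq] at hi hj
  rcases C.gap with h | h
  · omega
  · simp only [lowSlab, show C.m ≠ 1 by omega, if_false]
    refine disjoint_left.2 fun z hz hz' => ?_
    linarith [hz.2, hz'.1, (h i hi).2, C.g_mul_le hij]

theorem upSlab_disjoint : {j | j < C.m}.PairwiseDisjoint C.upSlab := by
  refine pairwiseDisjoint_of_lt fun i hi j hj hij => ?_
  simp only [mem_ofPred_eq] at hi hj
  rcases C.gap with h | h
  · omega
  · simp only [upSlab, show C.m ≠ 1 by omega, if_false]
    refine disjoint_left.2 fun z hz hz' => ?_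
    linarith [hz.2, hz'.1, (h j hj).1, C.g_mul_le hij]

variable {C}

/-- The set has no crossing of some vertical line between a left tooth and the right tooth
above it. -/
def LowBad (C : Comb) (K : Set (ℝ × ℝ)) (j : ℕ) : Prop :=
  ∃ c, 0 < c ∧ c < 2 * ((j : ℝ) + 1) ∧ ∀ z ∈ K, z.1 = c → z.2 ∉ C.lowSlab j

/-- The set has no crossing of some vertical line between a right tooth and the left tooth
above it. -/
def UpBad (C : Comb) (K : Set (ℝ × ℝ)) (j : ℕ) : Prop :=
  ∃ c, -(2 * ((j : ℝ) + 1)) < c ∧ c < 0 ∧ ∀ z ∈ K, z.1 = c → z.2 ∉ C.upSlab j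

theorem LowBad.exists_interval {K : Set (ℝ × ℝ)} (hK : IsPreconnected K) {j : ℕ} (hj : j < C.m)
    (hq : C.q j ∈ K) (hp : C.p j ∈ K) (h : C.LowBad K j) :
    ∃ a, Ioo a (a + C.e) ⊆ C.lowSlab j ∧
      ∀ y ∈ Ioo a (a + C.e), ¬ (K ∩ {z | z.2 = y}).Subsingleton := by
  obtain ⟨c, hc0, hc1, hno⟩ := h
  have hj0 : (0 : ℝ) ≤ j := j.cast_nonneg
  by_cases hm : C.m = 1
  · exfalso
    obtain ⟨z, hz, hzc⟩ := hK.intermediate_value hq hp continuous_fst.continuousOn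
      (show c ∈ Icc (C.q j).1 (C.p j).1 from ⟨by simp only [q]; linarith, hc1.le⟩)
    exact hno z hz hzc (by simp [lowSlab, hm])
  · have hgap := C.gap.resolve_left hm j hj
    simp only [lowSlab, hm, if_false] at hno ⊢
    exact exists_multiple_level_interval hK hq hp (Or.inl ⟨by simp only [q]; linarith, hc1⟩) C.e_pos
      (by simp only [q, p]; linarith [C.e_pos]) hno

theorem UpBad.exists_interval {K : Set (ℝ × ℝ)} (hK : IsPreconnected K) {j : ℕ} (hj : j < C.m)
    (hq : C.q (j + 1) ∈ K) (hp : C.p j ∈ K) (h : C.UpBad K j) :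
    ∃ a, Ioo a (a + C.e) ⊆ C.upSlab j ∧
      ∀ y ∈ Ioo a (a + C.e), ¬ (K ∩ {z | z.2 = y}).Subsingleton := by
  obtain ⟨c, hc0, hc1, hno⟩ := h
  have hj0 : (0 : ℝ) ≤ j := j.cast_nonneg
  by_cases hm : C.m = 1
  · exfalso
    obtain ⟨z, hz, hzc⟩ := hK.intermediate_value hq hp continuous_fst.continuousOn
      (show c ∈ Icc (C.q (j + 1)).1 (C.p j).1 from
        ⟨by simp only [q]; push_cast; linarith, by simp only [p]; linarith⟩)
    exact hno z hz hzc (by simp [upSlab, hm])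
  · have hgap := C.gap.resolve_left hm j hj
    simp only [upSlab, hm, if_false] at hno ⊢
    have := exists_multiple_level_interval hK hp hq
      (Or.inr ⟨by simp only [q]; push_cast; linarith, by simp only [p]; linarith⟩) C.e_pos
      (by simp only [q, p]; push_cast; linarith [C.e_pos])
      (c := c) (by simpa [p, q] using hno)
    simpa [p, q] using this

/-- A vertical line left of the comb that is crossed only once. -/
structure IsCut (C : Comb) (T : RectilinearTree) (c : ℝ) : Prop where
  gt : -C.M < c
  lt : c < -(2 * C.m)
  generic : T.IsGeneric xCoord c
  subsingleton : (T.carrier ∩ {z | z.1 = c}).Subsingleton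

variable {T : RectilinearTree} {c₀ : ℝ}

theorem IsCut.isPreconnected_right (h : C.IsCut T c₀) :
    IsPreconnected (T.carrier ∩ {z | c₀ ≤ z.1}) :=
  T.isPreconnected_carrier.inter_superlevel continuous_fst h.subsingleton

theorem IsCut.isPreconnected_left (h : C.IsCut T c₀) :
    IsPreconnected (T.carrier ∩ {z | z.1 ≤ c₀}) :=
  T.isPreconnected_carrier.inter_sublevel continuous_fst h.subsingleton

theorem IsCut.q_mem (h : C.IsCut T c₀) (hT : C.Spans T.carrier) {j : ℕ} (hj : j ≤ C.m) :
    C.q j ∈ T.carrier ∩ {z | c₀ ≤ z.1} := by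
  refine ⟨hT.q_mem j hj, ?_⟩
  have : (j : ℝ) ≤ C.m := by exact_mod_cast hj
  simp only [mem_ofPred_eq, q]
  linarith [h.lt]

theorem IsCut.p_mem (h : C.IsCut T c₀) (hT : C.Spans T.carrier) {j : ℕ} (hj : j < C.m) :
    C.p j ∈ T.carrier ∩ {z | c₀ ≤ z.1} := by
  refine ⟨hT.p_mem j hj, ?_⟩
  have : (0 : ℝ) ≤ j := j.cast_nonneg
  simp only [mem_ofPred_eq, p]
  linarith [h.lt, C.one_le_m']

theorem IsCut.exists_right (h : C.IsCut T c₀) (hT : C.Spans T.carrier) {y : ℝ}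
    (hy : y ∈ Ioo 0 (C.g * C.m)) : ∃ z ∈ T.carrier ∩ {z | c₀ ≤ z.1}, z.2 = y :=
  h.isPreconnected_right.intermediate_value (h.q_mem hT (Nat.zero_le _)) (h.q_mem hT le_rfl)
    continuous_snd.continuousOn ⟨by simpa [q] using hy.1.le, hy.2.le⟩

theorem IsCut.exists_left (h : C.IsCut T c₀) (hT : C.Spans T.carrier) {y : ℝ}
    (hy : y ∈ Ioo C.h (C.g * C.m)) : ∃ z ∈ T.carrier ∩ {z | z.1 ≤ c₀}, z.2 = y :=
  h.isPreconnected_left.intermediate_value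
    ⟨hT.low_mem, show C.X ≤ c₀ by linarith [C.X_le, h.gt]⟩ ⟨hT.high_mem, h.gt.le⟩
    continuous_snd.continuousOn ⟨hy.1.le, hy.2.le⟩

theorem IsCut.exists_left_finset (h : C.IsCut T c₀) (hT : C.Spans T.carrier) (y : ℝ) :
    ∃ A : Finset (ℝ × ℝ), (∀ z ∈ A, z ∈ T.carrier ∧ z.2 = y ∧ z.1 ≤ c₀) ∧
      (A.card : ℝ) = (Ioo C.h (C.g * C.m)).indicator 1 y := by
  by_cases hy : y ∈ Ioo C.h (C.g * C.m)
  · obtain ⟨z, hz, hzy⟩ := h.exists_left hT hy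
    refine ⟨{z}, by simpa [hzy] using hz, by simp [indicator_of_mem hy]⟩
  · exact ⟨∅, by simp, by simp [indicator_of_notMem hy]⟩

/-- Both sides of the cut are connected: the right one spans the levels of the trunk, the left one
those of the staircase. -/
theorem IsCut.yBase_le (h : C.IsCut T c₀) (hT : C.Spans T.carrier) {y : ℝ}
    (hy : T.IsGeneric yCoord y) : C.yBase y ≤ T.crossCount yCoord y := by
  obtain ⟨A, hA, hAc⟩ := h.exists_left_finset hT y
  unfold yBase
  by_cases hy0 : y ∈ Ioo 0 (C.g * C.m)
  · obtain ⟨z, hz, hzy⟩ := h.exists_right hT hy0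
    have := RectilinearTree.card_add_card_le_crossCount h.generic hy A {z} hA
      (by simpa [hzy] using hz)
    rw [← hAc, indicator_of_mem hy0]
    simpa using this
  · have := RectilinearTree.card_add_card_le_crossCount h.generic hy A ∅ hA (by simp)
    rw [← hAc, indicator_of_notMem hy0]
    simpa using this

theorem IsCut.yBase_add_one_le (h : C.IsCut T c₀) (hT : C.Spans T.carrier) {y : ℝ}
    (hy : T.IsGeneric yCoord y)
    (hs : ¬ (T.carrier ∩ {z | c₀ ≤ z.1} ∩ {z | z.2 = y}).Subsingleton) :
    C.yBase y + 1 ≤ T.crossCount yCoord y := by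
  obtain ⟨A, hA, hAc⟩ := h.exists_left_finset hT y
  rw [not_subsingleton_iff] at hs
  obtain ⟨z, hz, w, hw, hzw⟩ := hs
  have := RectilinearTree.card_add_card_le_crossCount h.generic hy A {z, w} hA (by
    intro x hx
    rcases Finset.mem_insert.1 hx with rfl | hx
    · exact ⟨hz.1.1, hz.2, hz.1.2⟩
    · rw [Finset.mem_singleton.1 hx]
      exact ⟨hw.1.1, hw.2, hw.1.2⟩)
  rw [Finset.card_pair hzw] at this
  unfold yBase
  rw [← hAc]
  have h1 : (Ioo 0 (C.g * C.m)).indicator (1 : ℝ → ℝ) y ≤ 1 :=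
    indicator_le_self' (by simp) y
  push_cast at this
  linarith

/-- Left of the comb connectedness gives one crossing. Over the teeth, each slab that is not bad
contains a crossing, and the slabs on one side of the trunk are disjoint. -/
theorem xPart_le (hT : C.Spans T.carrier) {s t : Finset ℕ} (hs : ∀ j ∈ s, j < C.m ∧ ¬ C.UpBad T.carrier j)
    (ht : ∀ j ∈ t, j < C.m ∧ ¬ C.LowBad T.carrier j) {c : ℝ} (hc : T.IsGeneric xCoord c)
    (hc0 : c ≠ 0) : C.xPart s t c ≤ T.crossCount xCoord c := by
  classical
  unfold xPart
  have hm := C.one_le_m'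
  rcases lt_or_ge c (-(2 * C.m)) with h1 | h1
  · rw [Finset.sum_eq_zero, Finset.sum_eq_zero, add_zero, add_zero]
    · by_cases h2 : c ∈ Ioo C.X (-(2 * C.m))
      · rw [indicator_of_mem h2]
        obtain ⟨z, hz, hzc⟩ := T.isPreconnected_carrier.intermediate_value hT.low_mem
          (hT.q_mem _ le_rfl) continuous_fst.continuousOn ⟨h2.1.le, h2.2.le⟩
        simpa using RectilinearTree.card_le_crossCount hc {z} (by simpa using ⟨hz, hzc⟩)
      · rw [indicator_of_notMem h2]
        simpa using RectilinearTree.card_le_crossCount hc ∅ (by simp)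
    · intro j _
      exact indicator_of_notMem (fun h => by linarith [h.1]) _
    · intro j hj
      have : (j : ℝ) + 1 ≤ C.m := by exact_mod_cast (hs j hj).1
      exact indicator_of_notMem (fun h => by linarith [h.1]) _
  rw [indicator_of_notMem (fun h => by linarith [h.2]), zero_add]
  rcases lt_or_gt_of_ne hc0 with h2 | h2
  · rw [Finset.sum_eq_zero (s := t) fun j _ => indicator_of_notMem (fun h => by linarith [h.1]) _,
      add_zero]
    simp only [indicator_apply, Pi.one_apply, Finset.sum_boole]
    refine RectilinearTree.card_le_crossCount_of_slabs hc _ C.upSlab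
      (C.upSlab_disjoint.subset fun j hj => ?_) fun j hj => ?_
    · exact (hs j (Finset.mem_filter.1 hj).1).1
    · obtain ⟨hj1, hj2⟩ := Finset.mem_filter.1 hj
      have := (hs j hj1).2
      simp only [UpBad, not_exists, not_and, not_forall, not_not] at this
      obtain ⟨z, hz, hz1, hz2⟩ := this c hj2.1 h2
      exact ⟨z, hz, hz1, hz2⟩
  · rw [Finset.sum_eq_zero (s := s) fun j _ => indicator_of_notMem (fun h => by linarith [h.2]) _,
      zero_add]
    simp only [indicator_apply, Pi.one_apply, Finset.sum_boole]
    refine RectilinearTree.card_le_crossCount_of_slabs hc _ C.lowSlab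
      (C.lowSlab_disjoint.subset fun j hj => ?_) fun j hj => ?_
    · exact (ht j (Finset.mem_filter.1 hj).1).1
    · obtain ⟨hj1, hj2⟩ := Finset.mem_filter.1 hj
      have := (ht j hj1).2
      simp only [LowBad, not_exists, not_and, not_forall, not_not] at this
      obtain ⟨z, hz, hz1, hz2⟩ := this c h2 hj2.2
      exact ⟨z, hz, hz1, hz2⟩

/-- Without a cut, almost every vertical line between `-M` and `-(2 * m)` is crossed twice, and by
the size of `M` the horizontal extent alone is already too long. -/
theorem optLength_lt_of_no_cut (hT : C.Spans T.carrier) (h : ¬ ∃ c, C.IsCut T c) :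
    C.optLength < T.length := by
  have hm := C.one_le_m'
  have h0 : 0 ≤ ∫ c, T.crossCount yCoord c := by
    refine integral_nonneg_of_ae ?_
    filter_upwards [T.ae_isGeneric yCoord] with c hc
    simpa using RectilinearTree.card_le_crossCount hc ∅ (by simp)
  have h1 : (2 * C.m - C.X) + (-(2 * C.m) - -C.M) ≤ ∫ c, T.crossCount xCoord c := by
    rw [← RectilinearTree.integral_indicator_Ioo (a := C.X) (b := 2 * C.m) (by linarith [C.X_lt]),
      ← RectilinearTree.integral_indicator_Ioo (a := -C.M) (b := -(2 * C.m))
        (by linarith [C.two_m_lt_M]),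
      ← integral_add (RectilinearTree.integrable_indicator_Ioo _ _)
        (RectilinearTree.integrable_indicator_Ioo _ _)]
    refine integral_mono_ae ((RectilinearTree.integrable_indicator_Ioo _ _).add
      (RectilinearTree.integrable_indicator_Ioo _ _)) (T.integrable_crossCount _) ?_
    filter_upwards [T.ae_isGeneric xCoord] with c hc
    by_cases h2 : c ∈ Ioo (-C.M) (-(2 * C.m))
    · have h3 : ¬ (T.carrier ∩ {z | z.1 = c}).Subsingleton :=
        fun hs => h ⟨c, h2.1, h2.2, hc, hs⟩
      rw [not_subsingleton_iff] at h3
      obtain ⟨z, hz, w, hw, hzw⟩ := h3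
      have := RectilinearTree.card_le_crossCount hc {z, w} (by
        intro x hx
        rcases Finset.mem_insert.1 hx with rfl | hx
        · exact hz
        · rw [Finset.mem_singleton.1 hx]; exact hw)
      rw [Finset.card_pair hzw] at this
      have h4 : (Ioo C.X (2 * C.m)).indicator (1 : ℝ → ℝ) c ≤ 1 :=
        indicator_le_self' (by simp) c
      rw [indicator_of_mem h2]
      simp only [Pi.one_apply]
      push_cast at this
      linarith
    · rw [indicator_of_notMem h2, add_zero]
      by_cases h3 : c ∈ Ioo C.X (2 * C.m)
      · rw [indicator_of_mem h3]
        have hmem := hT.p_mem (C.m - 1) (by have := C.one_le_m; omega)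
        obtain ⟨z, hz, hzc⟩ := T.isPreconnected_carrier.intermediate_value hT.low_mem
          hmem continuous_fst.continuousOn (show c ∈ _ from ⟨h3.1.le, by
            simp only [p, Nat.cast_sub C.one_le_m]; push_cast; linarith [h3.2]⟩)
        simpa using RectilinearTree.card_le_crossCount hc {z} (by simpa using ⟨hz, hzc⟩)
      · rw [indicator_of_notMem h3]
        simpa using RectilinearTree.card_le_crossCount hc ∅ (by simp)
  rw [T.length_eq_integral]
  unfold optLength
  nlinarith [C.M_gt, C.h_nonneg]

/-- Exchange argument: every bad slab loses one tooth in the vertical-line count but adds a window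
of `e` doubled levels. Equality leaves no bad slab, and then both pointwise inequalities of crossing
numbers are equalities almost everywhere. -/
theorem IsCut.optLength_le (h : C.IsCut T c₀) (hT : C.Spans T.carrier) :
    C.optLength ≤ T.length ∧ (T.length = C.optLength →
      (∀ᵐ c, T.crossCount xCoord c = C.xBase c) ∧ ∀ᵐ c, T.crossCount yCoord c = C.yBase c) := by
  classical
  have hae0 : ∀ᵐ c : ℝ, c ≠ 0 := by simp [ae_iff]
  have hyae : ∀ᵐ c, C.yBase c ≤ T.crossCount yCoord c := by
    filter_upwards [T.ae_isGeneric yCoord] with c hc using h.yBase_le hT hc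
  set U := (Finset.range C.m).filter fun j => C.UpBad T.carrier j with hU
  set L := (Finset.range C.m).filter fun j => C.LowBad T.carrier j with hL
  have hUv : (∫ c, C.yBase c) + C.e * U.card ≤ ∫ c, T.crossCount yCoord c := by
    have : ∀ j ∈ U, ∃ a, Ioo a (a + C.e) ⊆ C.upSlab j ∧ ∀ y ∈ Ioo a (a + C.e),
        ¬ (T.carrier ∩ {z | c₀ ≤ z.1} ∩ {z | z.2 = y}).Subsingleton := by
      intro j hj
      obtain ⟨hj1, c, hc1, hc2, hc3⟩ := Finset.mem_filter.1 hj
      have hj1 := Finset.mem_range.1 hj1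
      exact UpBad.exists_interval h.isPreconnected_right hj1 (h.q_mem hT hj1) (h.p_mem hT hj1)
        ⟨c, hc1, hc2, fun z hz => hc3 z hz.1⟩
    choose! a ha1 ha2 using this
    refine integral_add_card_le (T.integrable_crossCount _) C.integrable_yBase (a := a) C.e_pos.le
      ?_ hyae ?_
    · intro i hi j hj hij
      exact (C.upSlab_disjoint (by simpa using (Finset.mem_filter.1 hi).1)
        (by simpa using (Finset.mem_filter.1 hj).1) hij).mono (ha1 i hi) (ha1 j hj)
    · filter_upwards [T.ae_isGeneric yCoord] with c hc j hj hcj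
      exact h.yBase_add_one_le hT hc (ha2 j hj c hcj)
  have hLv : (∫ c, C.yBase c) + C.e * L.card ≤ ∫ c, T.crossCount yCoord c := by
    have : ∀ j ∈ L, ∃ a, Ioo a (a + C.e) ⊆ C.lowSlab j ∧ ∀ y ∈ Ioo a (a + C.e),
        ¬ (T.carrier ∩ {z | c₀ ≤ z.1} ∩ {z | z.2 = y}).Subsingleton := by
      intro j hj
      obtain ⟨hj1, c, hc1, hc2, hc3⟩ := Finset.mem_filter.1 hj
      have hj1 := Finset.mem_range.1 hj1
      exact LowBad.exists_interval h.isPreconnected_right hj1 (h.q_mem hT hj1.le) (h.p_mem hT hj1)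
        ⟨c, hc1, hc2, fun z hz => hc3 z hz.1⟩
    choose! a ha1 ha2 using this
    refine integral_add_card_le (T.integrable_crossCount _) C.integrable_yBase (a := a) C.e_pos.le
      ?_ hyae ?_
    · intro i hi j hj hij
      exact (C.lowSlab_disjoint (by simpa using (Finset.mem_filter.1 hi).1)
        (by simpa using (Finset.mem_filter.1 hj).1) hij).mono (ha1 i hi) (ha1 j hj)
    · filter_upwards [T.ae_isGeneric yCoord] with c hc j hj hcj
      exact h.yBase_add_one_le hT hc (ha2 j hj c hcj)
  have hxae : ∀ᵐ c, C.xPart (Finset.range C.m \ U) (Finset.range C.m \ L) c ≤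
      T.crossCount xCoord c := by
    filter_upwards [T.ae_isGeneric xCoord, hae0] with c hc hc0
    refine xPart_le hT ?_ ?_ hc hc0
    · intro j hj
      simp only [hU, Finset.mem_sdiff, Finset.mem_range, Finset.mem_filter, not_and] at hj
      exact ⟨hj.1, hj.2 hj.1⟩
    · intro j hj
      simp only [hL, Finset.mem_sdiff, Finset.mem_range, Finset.mem_filter, not_and] at hj
      exact ⟨hj.1, hj.2 hj.1⟩
  have hx := integral_mono_ae (C.integrable_xPart _ _) (T.integrable_crossCount xCoord) hxae
  have hcard : ∀ s ⊆ Finset.range C.m, ∑ j ∈ s, (2 * ((j : ℝ) + 1)) ≤ 2 * C.m * s.card := by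
    intro s hs
    rw [mul_comm, ← nsmul_eq_mul]
    refine Finset.sum_le_card_nsmul _ _ _ fun j hj => ?_
    have : (j : ℝ) + 1 ≤ C.m := by exact_mod_cast Finset.mem_range.1 (hs hj)
    linarith
  have hUs : U ⊆ Finset.range C.m := Finset.filter_subset _ _
  have hLs : L ⊆ Finset.range C.m := Finset.filter_subset _ _
  have hU1 := Finset.sum_sdiff (f := fun j : ℕ => 2 * ((j : ℝ) + 1)) hUs
  have hL1 := Finset.sum_sdiff (f := fun j : ℕ => 2 * ((j : ℝ) + 1)) hLs
  have hU2 := hcard U hUs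
  have hL2 := hcard L hLs
  rw [integral_xPart] at hx
  rw [sum_two_mul_succ] at hU1 hL1
  have hlen := T.length_eq_integral
  have hopt : C.optLength = (-(2 * C.m) - C.X) + 2 * (C.m * (C.m + 1)) + ∫ c, C.yBase c := by
    rw [integral_yBase, optLength]; ring
  -- Averages the bounds `hUv` and `hLv`, since the windows for `U` and for `L` need not be disjoint
  -- from each other.
  have key : C.optLength + (C.e - 4 * C.m) / 2 * (U.card + L.card) ≤ T.length := by
    rw [hlen, hopt]; linarith
  have hpos : 0 < (C.e - 4 * C.m) / 2 := by linarith [C.e_gt]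
  have hcards : (0 : ℝ) ≤ U.card + L.card := by positivity
  refine ⟨by nlinarith, fun heq => ?_⟩
  have hzero : (U.card : ℝ) + L.card = 0 := by nlinarith
  have hU0 : U = ∅ := Finset.card_eq_zero.1 (by exact_mod_cast (by
    linarith [(U.card.cast_nonneg : (0 : ℝ) ≤ U.card), (L.card.cast_nonneg : (0 : ℝ) ≤ L.card)] :
      (U.card : ℝ) = 0))
  have hL0 : L = ∅ := Finset.card_eq_zero.1 (by exact_mod_cast (by
    linarith [(U.card.cast_nonneg : (0 : ℝ) ≤ U.card), (L.card.cast_nonneg : (0 : ℝ) ≤ L.card)] :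
      (L.card : ℝ) = 0))
  rw [hU0, hL0, Finset.sdiff_empty] at hxae
  have hx' := integral_mono_ae C.integrable_xBase (T.integrable_crossCount xCoord) hxae
  have hy' := integral_mono_ae C.integrable_yBase (T.integrable_crossCount yCoord) hyae
  rw [hlen, C.optLength_eq] at heq
  constructor
  · have := (integral_eq_iff_of_ae_le C.integrable_xBase (T.integrable_crossCount xCoord) hxae).1
      (by linarith)
    filter_upwards [this] with c hc using hc.symm
  · have := (integral_eq_iff_of_ae_le C.integrable_yBase (T.integrable_crossCount yCoord) hyae).1
      (by linarith)
    filter_upwards [this] with c hc using hc.symm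

theorem optLength_le_length (hT : C.Spans T.carrier) : C.optLength ≤ T.length := by
  by_cases h : ∃ c, C.IsCut T c
  · obtain ⟨c, hc⟩ := h
    exact (hc.optLength_le hT).1
  · exact (optLength_lt_of_no_cut hT h).le

theorem exists_cut_of_length_eq (hT : C.Spans T.carrier) (h : T.length = C.optLength) :
    (∃ c, C.IsCut T c) ∧
      (∀ᵐ c, T.crossCount xCoord c = C.xBase c) ∧ ∀ᵐ c, T.crossCount yCoord c = C.yBase c := by
  by_cases hcut : ∃ c, C.IsCut T c
  · obtain ⟨c, hc⟩ := hcut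
    exact ⟨⟨c, hc⟩, (hc.optLength_le hT).2 h⟩
  · exact absurd h (optLength_lt_of_no_cut hT hcut).ne'

end Comb

/-! ### Trees that attain the bound. -/

theorem exists_mem_Ioo_of_ae {p : ℝ → Prop} (hp : ∀ᵐ c, p c) {a b : ℝ} (hab : a < b) :
    ∃ c ∈ Ioo a b, p c := by
  obtain ⟨c, hc, hpc⟩ := (Measure.dense_of_ae hp).inter_open_nonempty (Ioo a b) isOpen_Ioo
    (nonempty_Ioo.2 hab)
  exact ⟨c, hc, hpc⟩

theorem exists_pos_forall_lt (m : ℕ) (f : ℕ → ℝ) (hf : ∀ j < m, 0 < f j) :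
    ∃ ε > 0, ∀ j < m, ε < f j := by
  induction m with
  | zero => exact ⟨1, one_pos, by simp⟩
  | succ n ih =>
    obtain ⟨ε, hε, h⟩ := ih fun j hj => hf j (by omega)
    have hn := hf n (by omega)
    refine ⟨min ε (f n / 2), lt_min hε (by linarith), fun j hj => ?_⟩
    rcases Nat.lt_succ_iff_lt_or_eq.1 hj with hj | rfl
    · exact (min_le_left _ _).trans_lt (h j hj)
    · exact (min_le_right _ _).trans_lt (by linarith)

namespace Comb

/-- The tree contains the comb, has the length of the comb, and its crossing numbers with almost
all axis-parallel lines are those of the comb. -/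
structure IsTight (C : Comb) (T : RectilinearTree) (c₀ : ℝ) : Prop where
  cut : C.IsCut T c₀
  spans : C.Spans (T.verts : Set (ℝ × ℝ))
  xCount : ∀ᵐ c, T.crossCount xCoord c = C.xBase c
  yCount : ∀ᵐ c, T.crossCount yCoord c = C.yBase c

variable {C : Comb} {T : RectilinearTree} {c₀ : ℝ}

theorem Spans.mono {K K' : Set (ℝ × ℝ)} (h : C.Spans K) (hK : K ⊆ K') : C.Spans K' :=
  ⟨fun j hj => hK (h.q_mem j hj), fun j hj => hK (h.p_mem j hj), hK h.low_mem, hK h.high_mem⟩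

theorem Spans.carrier (h : C.Spans (T.verts : Set (ℝ × ℝ))) : C.Spans T.carrier :=
  h.mono fun _ hz => T.verts_subset_carrier hz

theorem xBase_eq {c : ℝ} (hc : c ∈ Ioo 0 2) : C.xBase c = C.m := by
  have hm := C.one_le_m'
  unfold xBase xPart
  rw [indicator_of_notMem (fun h => by linarith [h.2, hc.1]),
    Finset.sum_eq_zero fun j _ => indicator_of_notMem (fun h => by linarith [h.2, hc.1]) _]
  have h1 : ∀ j ∈ Finset.range C.m,
      (Ioo 0 (2 * ((j : ℝ) + 1))).indicator (1 : ℝ → ℝ) c = 1 := fun j _ => by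
    have : (0 : ℝ) ≤ j := j.cast_nonneg
    rw [indicator_of_mem (show c ∈ Ioo 0 (2 * ((j : ℝ) + 1)) from ⟨hc.1, by linarith [hc.2]⟩),
      Pi.one_apply]
  rw [Finset.sum_congr rfl h1]
  simp

/-- In a tight tree almost every level is met at most once right of the cut, so the three levels can
be chosen arbitrarily close to `u` and `v`. -/
theorem IsTight.exists_crossing (h : C.IsTight T c₀) {c ε : ℝ} (hε : 0 < ε) {u v : ℝ × ℝ}
    (hu : u ∈ T.carrier ∩ {z | c₀ ≤ z.1}) (hv : v ∈ T.carrier ∩ {z | c₀ ≤ z.1})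
    (hc : u.1 < c ∧ c < v.1 ∨ v.1 < c ∧ c < u.1) (huv : u.2 < v.2) :
    ∃ z ∈ T.carrier, z.1 = c ∧ z.2 ∈ Icc (u.2 - ε) (v.2 + ε) := by
  have hae : ∀ᵐ y, (T.carrier ∩ {z | c₀ ≤ z.1} ∩ {z | z.2 = y}).Subsingleton := by
    filter_upwards [h.yCount, T.ae_isGeneric yCoord] with y hy hg
    by_contra hs
    have := h.cut.yBase_add_one_le h.spans.carrier hg hs
    linarith
  obtain ⟨y₀, hy₀, hs₀⟩ := exists_mem_Ioo_of_ae hae (show u.2 - ε < u.2 by linarith)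
  obtain ⟨y₁, hy₁, hs₁⟩ := exists_mem_Ioo_of_ae hae huv
  obtain ⟨y₂, hy₂, hs₂⟩ := exists_mem_Ioo_of_ae hae (show v.2 < v.2 + ε by linarith)
  obtain ⟨z, hz, hzc, h1, h2⟩ := exists_crossing_of_levels h.cut.isPreconnected_right hu hv hc
    hy₀.2 hy₁.1 hy₁.2 hy₂.1 hs₀ hs₁ hs₂
  exact ⟨z, hz.1, hzc, by linarith [hy₀.1], by linarith [hy₂.2]⟩

/-- A point of the tree to the right of the trunk at an intermediate level forces an additional
crossing with the vertical lines between the trunk and the point. -/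
theorem IsTight.card_lt_crossCount (h : C.IsTight T c₀) {t : ℝ × ℝ} (ht : t ∈ T.carrier)
    (hty : T.IsGeneric yCoord t.2) (ht0 : t.2 ∈ Ioo 0 (C.g * C.m)) {c : ℝ}
    (hcg : T.IsGeneric xCoord c) (hc0 : 0 < c) (hct : c < t.1) (hc2 : c < 2) :
    (C.m : ℝ) + 1 ≤ T.crossCount xCoord c := by
  have hm := C.one_le_m'
  have hS := h.spans.carrier
  have htR : t ∈ T.carrier ∩ {z | c₀ ≤ z.1} := ⟨ht, show c₀ ≤ t.1 by linarith [h.cut.lt]⟩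
  have hyp : ∀ j < C.m, C.y j ≠ t.2 := fun j hj => hty _ (h.spans.p_mem j hj)
  have hyq : ∀ j ≤ C.m, C.g * j ≠ t.2 := fun j hj => hty _ (h.spans.q_mem j hj)
  obtain ⟨ε, hε, hlt⟩ := exists_pos_forall_lt C.m
    (fun j => min (min (C.g * (j + 1) - C.y j) (C.y j - C.g * j)) |C.y j - t.2| / 2)
    (fun j hj => by
      have h1 := C.lower j hj
      have h2 := C.upper j hj
      have h3 := abs_pos.2 (sub_ne_zero.2 (hyp j hj))
      have := lt_min (lt_min (sub_pos.2 h2) (sub_pos.2 h1)) h3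
      linarith)
  have e1 : ∀ j < C.m, C.y j + 2 * ε < C.g * (j + 1) := fun j hj => by
    have := hlt j hj
    have h1 := (min_le_left (min (C.g * (j + 1) - C.y j) (C.y j - C.g * j)) |C.y j - t.2|).trans
      (min_le_left _ _)
    linarith
  have e2 : ∀ j < C.m, C.g * j + 2 * ε < C.y j := fun j hj => by
    have := hlt j hj
    have h1 := (min_le_left (min (C.g * (j + 1) - C.y j) (C.y j - C.g * j)) |C.y j - t.2|).trans
      (min_le_right _ _)
    linarith
  have e3 : ∀ j < C.m, 2 * ε < |C.y j - t.2| := fun j hj => by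
    have := hlt j hj
    have h1 := min_le_right (min (C.g * (j + 1) - C.y j) (C.y j - C.g * j)) |C.y j - t.2|
    linarith
  have e4 : ∀ j < C.m, min (C.y j) t.2 + 2 * ε < max (C.y j) t.2 := fun j hj => by
    have := e3 j hj
    rw [← max_sub_min_eq_abs] at this
    rw [min_comm, max_comm]
    linarith
  -- One slab per left tooth, `m + 1` in all: below `t` it reaches up to the lower of `p j` and `t`,
  -- above `t` it reaches down to the higher of `p (j - 1)` and `t`. The truncated `j - 1` is
  -- harmless, as `t.2 > 0` excludes `j = 0` there.
  let lo : ℕ → ℝ := fun j => if C.g * j < t.2 then C.g * j else max (C.y (j - 1)) t.2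
  let hi : ℕ → ℝ := fun j => if C.g * j < t.2 then min (C.y j) t.2 else C.g * j
  have hlt_m : ∀ {j : ℕ}, C.g * j < t.2 → j < C.m := fun {j} hj => by
    by_contra hjm
    have : (C.m : ℝ) ≤ j := by exact_mod_cast not_lt.1 hjm
    have := mul_le_mul_of_nonneg_left this C.g_pos.le
    linarith [ht0.2]
  have hpos_j : ∀ {j : ℕ}, ¬ C.g * j < t.2 → ∃ i, j = i + 1 := fun {j} hj => by
    rcases j with _ | i
    · exact absurd (by simpa using ht0.1) hj
    · exact ⟨i, rfl⟩
  have key := RectilinearTree.card_le_crossCount_of_slabs hcg (Finset.range (C.m + 1))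
    (fun j => Icc (lo j - ε) (hi j + ε)) ?_ ?_
  · simpa using key
  · refine pairwiseDisjoint_of_lt fun i hi' j hj hij => disjoint_left.2 fun z hz hz' => ?_
    simp only [Finset.coe_range, mem_Iio] at hi' hj
    have hlast : hi i + 2 * ε < lo j := by
      have him : i < C.m := by omega
      have hgij := C.g_mul_le hij
      by_cases h1 : C.g * i < t.2
      · have hmin : min (C.y i) t.2 ≤ C.y i := min_le_left _ _
        by_cases h2 : C.g * j < t.2
        · simp only [hi, lo, h1, h2, if_true]
          linarith [e1 i him]
        · simp only [hi, lo, h1, h2, if_true, if_false]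
          obtain ⟨k, rfl⟩ := hpos_j h2
          simp only [Nat.add_sub_cancel]
          rcases Nat.lt_succ_iff_lt_or_eq.1 hij with hik | rfl
          · have := le_max_left (C.y k) t.2
            linarith [e1 i him, e2 k (by omega), C.g_mul_le hik]
          · exact e4 i him
      · have h2 : ¬ C.g * j < t.2 := fun h2 => h1 (by linarith [C.g_pos])
        simp only [hi, lo, h1, h2, if_false]
        obtain ⟨k, rfl⟩ := hpos_j h2
        simp only [Nat.add_sub_cancel]
        have hik : i ≤ k := by omega
        have : C.g * i ≤ C.g * k :=
          mul_le_mul_of_nonneg_left (by exact_mod_cast hik) C.g_pos.le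
        linarith [e2 k (by omega), le_max_left (C.y k) t.2]
    linarith [hz.2, hz'.1]
  · intro j hj
    have hj : j ≤ C.m := by simpa [Nat.lt_succ_iff] using hj
    have hj0 : (0 : ℝ) ≤ j := j.cast_nonneg
    by_cases h1 : C.g * j < t.2
    · have hjm := hlt_m h1
      simp only [hi, lo, h1, if_true]
      rcases le_total (C.y j) t.2 with h2 | h2
      · rw [min_eq_left h2]
        exact h.exists_crossing hε (h.cut.q_mem hS hj) (h.cut.p_mem hS hjm)
          (Or.inl ⟨by simp only [q]; linarith, by simp only [p]; linarith⟩) (C.lower j hjm)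
      · rw [min_eq_right h2]
        exact h.exists_crossing hε (h.cut.q_mem hS hj) htR
          (Or.inl ⟨by simp only [q]; linarith, hct⟩) h1
    · have h1' : t.2 < C.g * j := lt_of_le_of_ne (not_lt.1 h1) (hyq j hj).symm
      simp only [hi, lo, h1, if_false]
      obtain ⟨i, rfl⟩ := hpos_j h1
      simp only [Nat.add_sub_cancel]
      have hi0 : (0 : ℝ) ≤ i := i.cast_nonneg
      rcases le_total (C.y i) t.2 with h2 | h2
      · rw [max_eq_right h2]
        exact h.exists_crossing hε htR (h.cut.q_mem hS hj)
          (Or.inr ⟨by simp only [q]; linarith, hct⟩) h1'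
      · rw [max_eq_left h2]
        exact h.exists_crossing hε (h.cut.p_mem hS hj) (h.cut.q_mem hS hj)
          (Or.inr ⟨by simp only [q]; linarith, by simp only [p]; linarith⟩)
          (by simpa [p, q] using C.upper i hj)

/-- A vertical edge right of the trunk contains a point at a generic level, which forces `m + 1`
crossings close to the trunk where the comb has only `m`. -/
theorem IsTight.horizontal (h : C.IsTight T c₀) {u v : T.verts} (huv : T.graph.Adj u v)
    (hu : 0 < u.1.1) : u.1.2 = v.1.2 := by
  rcases T.axisParallel u v huv with hx | hy
  swap
  · exact hy
  by_contra hne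
  obtain ⟨y, hy, hyc, hyg⟩ := exists_mem_Ioo_of_ae (h.yCount.and (T.ae_isGeneric yCoord))
    (show min u.1.2 v.1.2 < max u.1.2 v.1.2 from min_lt_max.2 hne)
  have ht : (u.1.1, y) ∈ T.carrier := by
    refine T.edge_subset_carrier huv ?_
    have hz : u.1 = (u.1.1, u.1.2) ∧ v.1 = (u.1.1, v.1.2) := ⟨rfl, by rw [hx]⟩
    rw [hz.1, hz.2, ← Prod.image_mk_segment_right]
    exact ⟨y, by rw [segment_eq_uIcc]; exact ⟨hy.1.le, hy.2.le⟩, rfl⟩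
  have hy0 : y ∈ Ioo 0 (C.g * C.m) := by
    by_contra hy0
    have h1 := RectilinearTree.card_le_crossCount hyg {(u.1.1, y)} (by simpa using ht)
    rw [hyc] at h1
    unfold yBase at h1
    rw [indicator_of_notMem hy0, indicator_of_notMem
      fun h' => hy0 ⟨C.h_nonneg.trans_lt h'.1, h'.2⟩] at h1
    norm_num at h1
  obtain ⟨c, hc, hcc, hcg⟩ := exists_mem_Ioo_of_ae (h.xCount.and (T.ae_isGeneric xCoord))
    (show (0 : ℝ) < min u.1.1 2 from lt_min hu two_pos)
  have hc1 := hc.2.trans_le (min_le_left _ _)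
  have hc2 := hc.2.trans_le (min_le_right _ _)
  have := h.card_lt_crossCount ht hyg hy0 hcg hc.1 hc1 hc2
  rw [hcc, xBase_eq ⟨hc.1, hc2⟩] at this
  linarith

theorem IsTight.exists_vert_snd (h : C.IsTight T c₀) {z : ℝ × ℝ} (hz : z ∈ T.carrier)
    (hz0 : 0 < z.1) : ∃ u ∈ T.verts, u.2 = z.2 := by
  rcases hz with hz | ⟨u, v, huv, hz⟩
  · exact ⟨z, hz, rfl⟩
  · have hx : z.1 ∈ segment ℝ u.1.1 v.1.1 := by
      have := mem_image_of_mem xCoord hz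
      rwa [← LinearMap.coe_toAffineMap, image_segment] at this
    have hy : z.2 ∈ segment ℝ u.1.2 v.1.2 := by
      have := mem_image_of_mem yCoord hz
      rwa [← LinearMap.coe_toAffineMap, image_segment] at this
    have huv2 : u.1.2 = v.1.2 := by
      rcases T.axisParallel u v huv with h1 | h1
      · rw [← h1, segment_same, mem_singleton_iff] at hx
        exact h.horizontal huv (hx ▸ hz0)
      · exact h1
    rw [← huv2, segment_same, mem_singleton_iff] at hy
    exact ⟨u, u.2, hy.symm⟩

/-- Right of the trunk only heights of vertices occur. In a band around `z` so thin that it contains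
no other vertex height, the tree can leave towards the trunk only through x = c at exactly the
height of `z`. -/
theorem IsTight.mem_of_lt (h : C.IsTight T c₀) {z : ℝ × ℝ} (hz : z ∈ T.carrier) {c : ℝ}
    (hc0 : 0 < c) (hc : c < z.1) : (c, z.2) ∈ T.carrier := by
  classical
  obtain ⟨η, hη, hsep⟩ : ∃ η > 0, ∀ u ∈ T.verts, |u.2 - z.2| ≤ η → u.2 = z.2 := by
    have hfin : ((fun u : ℝ × ℝ => u.2) '' (T.verts : Set (ℝ × ℝ)) \ {z.2}).Finite :=
      (T.verts.finite_toSet.image _).sdiff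
    have hnhds := hfin.isClosed.isOpen_compl.mem_nhds (x := z.2) (by simp)
    obtain ⟨η, hη, hb⟩ := Metric.nhds_basis_closedBall.mem_iff.1 hnhds
    refine ⟨η, hη, fun u hu huz => ?_⟩
    by_contra hne
    exact hb (by simpa [Real.dist_eq] using huz) ⟨⟨u, hu, rfl⟩, hne⟩
  obtain ⟨w, hw, h1, h2, h3⟩ := T.isPreconnected_carrier.exists_corner
    (f := fun w => w.1 - c) (g := fun w => η - |w.2 - z.2|) (by fun_prop) (by fun_prop) hz
    (h.spans.carrier.q_mem 0 (Nat.zero_le _)) (by simpa using hc) (by simpa using hη)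
    (Or.inl (by simp [q]; exact hc0.le))
  simp only [sub_nonneg] at h1 h2
  obtain ⟨u, hu, huw⟩ := h.exists_vert_snd hw (hc0.trans_le h1)
  have hwz : w.2 = z.2 := by rw [← huw]; exact hsep u hu (by rwa [huw])
  simp only [hwz, sub_self, abs_zero, sub_zero, sub_eq_zero, hη.ne', or_false] at h3
  rwa [← h3, ← hwz]

theorem IsTight.treeCrossings_eq (h : C.IsTight T c₀) :
    treeCrossings T 1 = (fun j => ((1 : ℝ), C.y j)) '' {j | j < C.m} := by
  classical
  have hp : ∀ j < C.m, ∀ c, 0 < c → c < 2 → (c, C.y j) ∈ T.carrier := fun j hj c hc hc2 =>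
    h.mem_of_lt (h.spans.carrier.p_mem j hj) hc (by
      have : (0 : ℝ) ≤ j := j.cast_nonneg
      simp only [p]; linarith)
  refine Subset.antisymm ?_ ?_
  · rintro ⟨x, b⟩ ⟨hz, hx⟩
    obtain rfl : x = 1 := hx
    by_contra hb
    -- The line x = 1 may fail to be generic; all its crossings extend horizontally to a generic
    -- line nearer the trunk, where the count is known.
    obtain ⟨c, hc, hcc, hcg⟩ := exists_mem_Ioo_of_ae (h.xCount.and (T.ae_isGeneric xCoord))
      (show (0 : ℝ) < 1 from one_pos)
    have hinj : Set.InjOn (fun j => (c, C.y j)) (Finset.range C.m : Set ℕ) := by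
      intro i hi j hj hij
      simp only [Finset.coe_range, mem_Iio] at hi hj
      have hij : C.y i = C.y j := congrArg Prod.snd hij
      by_contra hne
      rcases lt_or_gt_of_ne hne with hlt | hlt
      · linarith [C.upper i hi, C.lower j hj, C.g_mul_le hlt]
      · linarith [C.upper j hj, C.lower i hi, C.g_mul_le hlt]
    have hnot : (c, b) ∉ (Finset.range C.m).image fun j => (c, C.y j) := by
      intro hmem
      obtain ⟨j, hj, hjb⟩ := Finset.mem_image.1 hmem
      exact hb ⟨j, Finset.mem_range.1 hj, by simpa using congrArg Prod.snd hjb⟩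
    have := RectilinearTree.card_le_crossCount hcg
      (insert (c, b) ((Finset.range C.m).image fun j => (c, C.y j))) (by
        intro z hz'
        rcases Finset.mem_insert.1 hz' with rfl | hz'
        · exact ⟨h.mem_of_lt hz hc.1 hc.2, rfl⟩
        · obtain ⟨j, hj, rfl⟩ := Finset.mem_image.1 hz'
          exact ⟨hp j (Finset.mem_range.1 hj) c hc.1 (by linarith [hc.2]), rfl⟩)
    rw [Finset.card_insert_of_notMem hnot, Finset.card_image_of_injOn hinj, hcc,
      xBase_eq ⟨hc.1, by linarith [hc.2]⟩, Finset.card_range] at this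
    push_cast at this
    linarith
  · rintro _ ⟨j, hj, rfl⟩
    exact ⟨hp j hj 1 one_pos one_lt_two, rfl⟩

/-- The horizontal retraction onto x ≤ 1 maps the tree into itself, so a path that strays to the
right can be pushed back. -/
theorem IsTight.joinedIn (h : C.IsTight T c₀) {z w : ℝ × ℝ} (hz : z ∈ treeCrossings T 1)
    (hw : w ∈ treeCrossings T 1) : JoinedIn (T.carrier ∩ {z | z.1 ≤ 1}) z w := by
  have hmap := (T.joinedIn_carrier hz.1 hw.1).map_continuousOn
    (f := fun z : ℝ × ℝ => (min z.1 1, z.2)) (by fun_prop)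
  have hfix : ∀ z ∈ treeCrossings T 1, (min z.1 1, z.2) = z := fun z hz => by
    have : z.1 = 1 := hz.2
    ext <;> simp [this]
  simp only [hfix z hz, hfix w hw] at hmap
  refine hmap.mono ?_
  rintro _ ⟨x, hx, rfl⟩
  refine ⟨?_, min_le_right x.1 1⟩
  rcases le_or_gt x.1 1 with h1 | h1
  · simpa [min_eq_left h1] using hx
  · simpa [min_eq_right h1.le] using h.mem_of_lt hx one_pos h1

theorem IsTight.crossingPattern_eq (h : C.IsTight T c₀) :
    crossingPattern T 1 = {(fun j => ((1 : ℝ), C.y j)) '' {j | j < C.m}} := by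
  rw [← h.treeCrossings_eq]
  have hone : ∀ p ∈ treeCrossings T 1,
      {q ∈ treeCrossings T 1 | JoinedIn (T.carrier ∩ {z | z.1 ≤ 1}) p q} = treeCrossings T 1 :=
    fun p hp => by
      ext q
      exact ⟨fun hq => hq.1, fun hq => ⟨hq, h.joinedIn hp hq⟩⟩
  ext B
  constructor
  · rintro ⟨p, hp, rfl⟩
    exact hone p hp
  · rintro rfl
    have hmem : ((1 : ℝ), C.y 0) ∈ treeCrossings T 1 := by
      rw [h.treeCrossings_eq]; exact ⟨0, C.one_le_m, rfl⟩
    exact ⟨_, hmem, (hone _ hmem).symm⟩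

theorem crossingPattern_eq_of_length_eq (hT : C.Spans (T.verts : Set (ℝ × ℝ)))
    (h : T.length = C.optLength) :
    crossingPattern T 1 = {(fun j => ((1 : ℝ), C.y j)) '' {j | j < C.m}} := by
  obtain ⟨⟨c, hc⟩, hx, hy⟩ := exists_cut_of_length_eq hT.carrier h
  exact IsTight.crossingPattern_eq ⟨hc, hT, hx, hy⟩

end Comb

/-! ### Attaching leaves to a tree. -/

namespace RectilinearTree

theorem exists_neighbor (T : RectilinearTree) {a b : T.verts} (hab : T.graph.Adj a b)
    (u : T.verts) : ∃ w, T.graph.Adj u w := by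
  obtain ⟨p⟩ := T.isTree.connected.preconnected u a
  cases p with
  | nil => exact ⟨b, hab⟩
  | cons h _ => exact ⟨_, h⟩

/-- The overlap axiom speaks of edges only; it applies to the vertex `u` through any edge at `u`. -/
theorem eq_or_eq_of_mem_segment (T : RectilinearTree) {a b : T.verts} (hab : T.graph.Adj a b)
    {u : T.verts} (hu : u.1 ∈ segment ℝ a.1 b.1) : u.1 = a.1 ∨ u.1 = b.1 := by
  obtain ⟨w, hw⟩ := T.exists_neighbor hab u
  by_cases h : s(a, b) = s(u, w)
  · rcases Sym2.eq_iff.1 h with ⟨rfl, -⟩ | ⟨-, rfl⟩ <;> simp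
  · simpa using (T.overlap a b u w hab hw h ⟨hu, left_mem_segment ℝ _ _⟩).1

section AddLeaf

variable (T : RectilinearTree) {v : ℝ × ℝ} (u : T.verts)

open Classical in
/-- The inclusion of the old vertices into the vertices with one more point. -/
noncomputable def inclLeaf (v : ℝ × ℝ) : T.verts ↪ (insert v T.verts : Finset (ℝ × ℝ)) :=
  ⟨fun w => ⟨w.1, Finset.mem_insert_of_mem w.2⟩, fun _ _ h => Subtype.ext (congrArg (fun x => x.1) h)⟩

open Classical in
/-- The graph of the tree with a leaf attached. -/
noncomputable def leafGraph (v : ℝ × ℝ) : SimpleGraph (insert v T.verts : Finset (ℝ × ℝ)) :=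
  T.graph.map (T.inclLeaf v) ⊔
    SimpleGraph.edge (T.inclLeaf v u) ⟨v, Finset.mem_insert_self _ _⟩

theorem inclLeaf_ne (hv : v ∉ T.verts) (w : T.verts) :
    T.inclLeaf v w ≠ ⟨v, Finset.mem_insert_self _ _⟩ := fun h => by
  have : w.1 = v := congrArg (fun x => x.1) h
  exact hv (this ▸ w.2)

theorem leafGraph_adj {a b} (h : (T.leafGraph u v).Adj a b) :
    (∃ a' b', T.graph.Adj a' b' ∧ T.inclLeaf v a' = a ∧ T.inclLeaf v b' = b) ∨
      s(a, b) = s(T.inclLeaf v u, ⟨v, Finset.mem_insert_self _ _⟩) := by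
  rcases h with h | h
  · exact Or.inl ((SimpleGraph.map_adj _ _ _ _).1 h)
  · right
    rw [SimpleGraph.edge_adj] at h
    exact Sym2.eq_iff.2 h.1

theorem leafGraph_adj_incl {a b : T.verts} (h : T.graph.Adj a b) :
    (T.leafGraph u v).Adj (T.inclLeaf v a) (T.inclLeaf v b) :=
  Or.inl ((SimpleGraph.map_adj _ _ _ _).2 ⟨a, b, h, rfl, rfl⟩)

theorem leafGraph_adj_leaf (hv : v ∉ T.verts) :
    (T.leafGraph u v).Adj (T.inclLeaf v u) ⟨v, Finset.mem_insert_self _ _⟩ :=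
  Or.inr ((SimpleGraph.edge_adj _ _ _ _).2 ⟨Or.inl ⟨rfl, rfl⟩, T.inclLeaf_ne hv u⟩)

open Classical in
theorem leafGraph_edgeFinset (hv : v ∉ T.verts) : (T.leafGraph u v).edgeFinset =
    insert s(T.inclLeaf v u, ⟨v, Finset.mem_insert_self _ _⟩)
      (T.graph.edgeFinset.map (T.inclLeaf v).sym2Map) := by
  ext e
  induction e using Sym2.ind with
  | _ a b =>
    simp only [SimpleGraph.mem_edgeFinset, SimpleGraph.mem_edgeSet, Finset.mem_insert,
      Finset.mem_map, Function.Embedding.sym2Map_apply]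
    constructor
    · intro h
      rcases T.leafGraph_adj u h with ⟨a', b', h', rfl, rfl⟩ | h'
      · exact Or.inr ⟨s(a', b'), h', rfl⟩
      · exact Or.inl h'
    · rintro (h | ⟨e, he, h⟩)
      · have := T.leafGraph_adj_leaf u hv
        rw [← SimpleGraph.mem_edgeSet] at this ⊢
        rwa [h]
      · induction e using Sym2.ind with
        | _ a' b' =>
          have := T.leafGraph_adj_incl u (v := v) (show T.graph.Adj a' b' from he)
          rw [← SimpleGraph.mem_edgeSet] at this ⊢
          rwa [← h]

open Classical in
theorem leaf_edge_notMem (hv : v ∉ T.verts) : s(T.inclLeaf v u, ⟨v, Finset.mem_insert_self _ _⟩) ∉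
    (T.graph.edgeFinset.map (T.inclLeaf v).sym2Map) := by
  intro h
  obtain ⟨e, -, h⟩ := Finset.mem_map.1 h
  induction e using Sym2.ind with
  | _ a b =>
    rcases Sym2.eq_iff.1 h with ⟨-, h⟩ | ⟨h, -⟩
    · exact T.inclLeaf_ne hv _ h
    · exact T.inclLeaf_ne hv _ h

theorem leafGraph_isTree (hv : v ∉ T.verts) : (T.leafGraph u v).IsTree := by
  classical
  rw [SimpleGraph.isTree_iff_connected_and_card]
  constructor
  · rw [SimpleGraph.connected_iff_exists_forall_reachable]
    refine ⟨T.inclLeaf v u, fun w => ?_⟩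
    obtain ⟨w, hw⟩ := w
    rcases Finset.mem_insert.1 hw with rfl | hw
    · exact (T.leafGraph_adj_leaf u hv).reachable
    · exact (T.isTree.connected.preconnected u ⟨w, hw⟩).map
        (⟨T.inclLeaf v, fun h => T.leafGraph_adj_incl u h⟩ : T.graph →g T.leafGraph u v)
  · have h1 := T.isTree.card_edgeFinset
    rw [Nat.card_eq_fintype_card, ← SimpleGraph.edgeFinset_card, T.leafGraph_edgeFinset u hv,
      Finset.card_insert_of_notMem (T.leaf_edge_notMem u hv), Finset.card_map, h1,
      Nat.card_eq_fintype_card, Fintype.card_coe, Fintype.card_coe, Finset.card_insert_of_notMem hv]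

theorem exists_addLeaf_aux (hax : u.1.1 = v.1 ∨ u.1.2 = v.2) (hv : v ∉ T.verts)
    (hcap : segment ℝ u.1 v ∩ T.carrier ⊆ {u.1}) :
    ∃ T' : RectilinearTree, (∀ z, z ∈ T'.verts ↔ z = v ∨ z ∈ T.verts) ∧
      T'.carrier = T.carrier ∪ segment ℝ u.1 v ∧
      T'.length = T.length + (|u.1.1 - v.1| + |u.1.2 - v.2|) := by
  classical
  have hcross : ∀ {a b : T.verts}, T.graph.Adj a b →
      segment ℝ a.1 b.1 ∩ segment ℝ u.1 v ⊆ ({a.1, b.1} : Set (ℝ × ℝ)) ∩ {u.1, v} := by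
    rintro a b hab z ⟨hz1, hz2⟩
    obtain rfl : z = u.1 := hcap ⟨hz2, T.edge_subset_carrier hab hz1⟩
    exact ⟨by simpa using T.eq_or_eq_of_mem_segment hab hz1, by simp⟩
  let T' : RectilinearTree :=
    { verts := insert v T.verts
      graph := T.leafGraph u v
      isTree := T.leafGraph_isTree u hv
      axisParallel := by
        intro a b hab
        rcases T.leafGraph_adj u hab with ⟨a', b', h', rfl, rfl⟩ | h'
        · exact T.axisParallel a' b' h'
        · rcases Sym2.eq_iff.1 h' with ⟨rfl, rfl⟩ | ⟨rfl, rfl⟩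
          · exact hax
          · exact hax.imp Eq.symm Eq.symm
      overlap := by
        intro a b c d hab hcd hne
        rcases T.leafGraph_adj u hab with ⟨a', b', h', rfl, rfl⟩ | h' <;>
          rcases T.leafGraph_adj u hcd with ⟨c', d', h'', rfl, rfl⟩ | h''
        · refine T.overlap a' b' c' d' h' h'' fun h => hne ?_
          rcases Sym2.eq_iff.1 h with ⟨rfl, rfl⟩ | ⟨rfl, rfl⟩
          · rfl
          · exact Sym2.eq_swap
        · rcases Sym2.eq_iff.1 h'' with ⟨rfl, rfl⟩ | ⟨rfl, rfl⟩
          · exact hcross h'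
          · rw [segment_symm ℝ v, Set.pair_comm v]
            exact hcross h'
        · rw [Set.inter_comm, Set.inter_comm ({a.1, b.1} : Set (ℝ × ℝ))]
          rcases Sym2.eq_iff.1 h' with ⟨rfl, rfl⟩ | ⟨rfl, rfl⟩
          · exact hcross h''
          · rw [segment_symm ℝ v, Set.pair_comm v]
            exact hcross h''
        · exact absurd (h'.trans h''.symm) hne }
  refine ⟨T', fun z => Finset.mem_insert, ?_, ?_⟩
  · ext z
    constructor
    · rintro (hz | ⟨a, b, hab, hz⟩)
      · rcases Finset.mem_insert.1 hz with rfl | hz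
        · exact Or.inr (right_mem_segment ℝ _ _)
        · exact Or.inl (Or.inl hz)
      · rcases T.leafGraph_adj u hab with ⟨a', b', h', rfl, rfl⟩ | h'
        · exact Or.inl (T.edge_subset_carrier h' hz)
        · right
          rcases Sym2.eq_iff.1 h' with ⟨rfl, rfl⟩ | ⟨rfl, rfl⟩
          · exact hz
          · rw [segment_symm]; exact hz
    · rintro ((hz | ⟨a, b, hab, hz⟩) | hz)
      · exact Or.inl (Finset.mem_insert_of_mem hz)
      · exact Or.inr ⟨_, _, T.leafGraph_adj_incl u hab, hz⟩
      · exact Or.inr ⟨_, _, T.leafGraph_adj_leaf u hv, hz⟩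
  · have h1 : T'.length = ∑ e ∈ (T.leafGraph u v).edgeFinset, edgeLength e := rfl
    rw [h1, T.leafGraph_edgeFinset u hv, Finset.sum_insert (T.leaf_edge_notMem u hv),
      Finset.sum_map, add_comm]
    congr 1
    refine Finset.sum_congr rfl fun e _ => ?_
    induction e using Sym2.ind with
    | _ a b => rfl

end AddLeaf

/-- A tree can be extended by a segment that meets it only in a vertex. -/
theorem exists_addLeaf (T : RectilinearTree) {u v : ℝ × ℝ} (hu : u ∈ T.verts)
    (hax : u.1 = v.1 ∨ u.2 = v.2) (hcap : ∀ z ∈ segment ℝ u v, z ∈ T.carrier → z = u) :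
    ∃ T' : RectilinearTree, (∀ z, z ∈ T'.verts ↔ z = v ∨ z ∈ T.verts) ∧
      T'.carrier = T.carrier ∪ segment ℝ u v ∧
      T'.length = T.length + (|u.1 - v.1| + |u.2 - v.2|) := by
  rcases eq_or_ne u v with rfl | huv
  · refine ⟨T, fun z => ⟨Or.inr, ?_⟩, ?_, by simp⟩
    · rintro (rfl | h)
      exacts [hu, h]
    · rw [segment_same, Set.union_eq_left.2]
      exact Set.singleton_subset_iff.2 (T.verts_subset_carrier hu)
  · refine T.exists_addLeaf_aux ⟨u, hu⟩ hax (fun h => huv ?_) fun z hz => hcap z hz.1 hz.2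
    exact (hcap v (right_mem_segment ℝ _ _) (T.verts_subset_carrier h)).symm

/-- The tree with a single vertex. -/
def point (z : ℝ × ℝ) : RectilinearTree where
  verts := {z}
  graph := ⊥
  isTree := SimpleGraph.IsTree.of_subsingleton
  axisParallel := fun _ _ h => h.elim
  overlap := fun _ _ _ _ h => h.elim

theorem carrier_point (z : ℝ × ℝ) : (point z).carrier = {z} := by
  ext w
  constructor
  · rintro (h | ⟨_, _, h, _⟩)
    · exact Finset.mem_singleton.1 h
    · exact h.elim
  · rintro rfl
    exact Or.inl (Finset.mem_singleton_self _)

theorem length_point (z : ℝ × ℝ) : (point z).length = 0 := by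
  classical
  refine Finset.sum_eq_zero fun e he => ?_
  induction e using Sym2.ind with
  | _ a b => exact ((SimpleGraph.mem_edgeFinset.1 he : (⊥ : SimpleGraph _).Adj a b)).elim

end RectilinearTree

/-! ### Building a tree of the comb length. -/

namespace RectilinearTree

theorem mem_segment_vertical {x a b : ℝ} {z : ℝ × ℝ} (hz : z ∈ segment ℝ (x, a) (x, b)) :
    z.1 = x ∧ z.2 ∈ uIcc a b := by
  rw [← Prod.image_mk_segment_right, segment_eq_uIcc] at hz
  obtain ⟨y, hy, rfl⟩ := hz
  exact ⟨rfl, hy⟩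

theorem mem_segment_horizontal {y a b : ℝ} {z : ℝ × ℝ} (hz : z ∈ segment ℝ (a, y) (b, y)) :
    z.2 = y ∧ z.1 ∈ uIcc a b := by
  rw [← Prod.image_mk_segment_left, segment_eq_uIcc] at hz
  obtain ⟨x, hx, rfl⟩ := hz
  exact ⟨rfl, hx⟩

/-- Extending a trunk upwards and attaching a horizontal tooth at its new end. -/
theorem exists_addTooth (T : RectilinearTree) {a b : ℝ} (x : ℝ) (ha : (0, a) ∈ T.verts)
    (hT : ∀ z ∈ T.carrier, z.2 ≤ a) (hab : a < b) :
    ∃ T' : RectilinearTree, (∀ z ∈ T.verts, z ∈ T'.verts) ∧ (0, b) ∈ T'.verts ∧ (x, b) ∈ T'.verts ∧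
      (∀ z ∈ T'.carrier, z ∈ T.carrier ∨ z.1 = 0 ∨ z.2 = b ∧ z.1 ∈ uIcc 0 x) ∧
      (∀ z ∈ T'.carrier, z.2 ≤ b) ∧ T'.length = T.length + (b - a) + |x| := by
  obtain ⟨T₁, hv₁, hc₁, hl₁⟩ := T.exists_addLeaf (v := (0, b)) ha (Or.inl rfl) (by
    intro z hz hzT
    obtain ⟨h1, h2⟩ := mem_segment_vertical hz
    rw [uIcc_of_le hab.le] at h2
    exact Prod.ext h1 (le_antisymm (hT z hzT) h2.1))
  obtain ⟨T₂, hv₂, hc₂, hl₂⟩ := T₁.exists_addLeaf (u := (0, b)) (v := (x, b)) ((hv₁ _).2 (Or.inl rfl))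
    (Or.inr rfl) (by
      intro z hz hzT
      obtain ⟨h1, h2⟩ := mem_segment_horizontal hz
      rw [hc₁] at hzT
      rcases hzT with hzT | hzT
      · linarith [hT z hzT]
      · exact Prod.ext (mem_segment_vertical hzT).1 h1)
  refine ⟨T₂, fun z hz => (hv₂ z).2 (Or.inr ((hv₁ z).2 (Or.inr hz))),
    (hv₂ _).2 (Or.inr ((hv₁ _).2 (Or.inl rfl))), (hv₂ _).2 (Or.inl rfl), ?_, ?_, ?_⟩
  · intro z hz
    rw [hc₂, hc₁] at hz
    rcases hz with (hz | hz) | hz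
    · exact Or.inl hz
    · exact Or.inr (Or.inl (mem_segment_vertical hz).1)
    · exact Or.inr (Or.inr (mem_segment_horizontal hz))
  · intro z hz
    rw [hc₂, hc₁] at hz
    rcases hz with (hz | hz) | hz
    · exact (hT z hz).trans hab.le
    · have := (mem_segment_vertical hz).2
      rw [uIcc_of_le hab.le] at this
      exact this.2
    · exact (mem_segment_horizontal hz).1.le
  · rw [hl₂, hl₁]
    simp [abs_sub_comm a b, abs_of_pos (sub_pos.2 hab)]

/-- Extending a tree to the left by a step of a staircase. -/
theorem exists_addStep (T : RectilinearTree) {a b h : ℝ} (h' : ℝ) (ha : (a, h) ∈ T.verts)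
    (hT : ∀ z ∈ T.carrier, a ≤ z.1) (hab : b < a) :
    ∃ T' : RectilinearTree, (∀ z ∈ T.verts, z ∈ T'.verts) ∧ (b, h') ∈ T'.verts ∧
      (∀ z ∈ T'.carrier, z ∈ T.carrier ∨ z.2 = h ∨ z.1 = b) ∧
      (∀ z ∈ T'.carrier, b ≤ z.1) ∧ T'.length = T.length + (a - b) + |h - h'| := by
  obtain ⟨T₁, hv₁, hc₁, hl₁⟩ := T.exists_addLeaf (v := (b, h)) ha (Or.inr rfl) (by
    intro z hz hzT
    obtain ⟨h1, h2⟩ := mem_segment_horizontal hz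
    rw [uIcc_of_ge hab.le] at h2
    exact Prod.ext (le_antisymm h2.2 (hT z hzT)) h1)
  obtain ⟨T₂, hv₂, hc₂, hl₂⟩ := T₁.exists_addLeaf (u := (b, h)) (v := (b, h'))
    ((hv₁ _).2 (Or.inl rfl)) (Or.inl rfl) (by
      intro z hz hzT
      obtain ⟨h1, h2⟩ := mem_segment_vertical hz
      rw [hc₁] at hzT
      rcases hzT with hzT | hzT
      · linarith [hT z hzT]
      · exact Prod.ext h1 (mem_segment_horizontal hzT).1)
  refine ⟨T₂, fun z hz => (hv₂ z).2 (Or.inr ((hv₁ z).2 (Or.inr hz))),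
    (hv₂ _).2 (Or.inl rfl), ?_, ?_, ?_⟩
  · intro z hz
    rw [hc₂, hc₁] at hz
    rcases hz with (hz | hz) | hz
    · exact Or.inl hz
    · exact Or.inr (Or.inl (mem_segment_horizontal hz).1)
    · exact Or.inr (Or.inr (mem_segment_vertical hz).1)
  · intro z hz
    rw [hc₂, hc₁] at hz
    rcases hz with (hz | hz) | hz
    · exact hab.le.trans (hT z hz)
    · have := (mem_segment_horizontal hz).2
      rw [uIcc_of_ge hab.le] at this
      exact this.1
    · exact (mem_segment_vertical hz).1.ge
  · rw [hl₂, hl₁]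
    simp [abs_of_pos (sub_pos.2 hab)]

end RectilinearTree

namespace Comb

variable (C : Comb)

/-- The induction adds a right tooth and then a left one. The bounds on both coordinates are its
invariants: nothing lies above the trunk's end or left of the last left tooth, so the next pieces
meet the tree only where they are attached. -/
theorem exists_trunk (Q : Finset (ℝ × ℝ)) (hq : ∀ j ≤ C.m, C.q j ∈ Q) (hp : ∀ j < C.m, C.p j ∈ Q)
    (j : ℕ) (hj : j ≤ C.m) :
    ∃ T : RectilinearTree, (∀ i ≤ j, C.q i ∈ T.verts) ∧ (∀ i < j, C.p i ∈ T.verts) ∧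
      (0, C.g * j) ∈ T.verts ∧ (∀ z ∈ T.carrier, z.2 ≤ C.g * j) ∧
      (∀ z ∈ T.carrier, -(2 * (j : ℝ)) ≤ z.1) ∧ T.carrier ⊆ hananGrid Q ∧
      T.length = C.g * j + 2 * (j * (j + 1)) := by
  induction j with
  | zero =>
    have hc := RectilinearTree.carrier_point (C.q 0)
    have hv : (RectilinearTree.point (C.q 0)).verts = {C.q 0} := rfl
    refine ⟨RectilinearTree.point (C.q 0), ?_, by simp, ?_, ?_, ?_, ?_, ?_⟩
    · intro i hi
      obtain rfl : i = 0 := by omega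
      simp [hv]
    · rw [hv]; simp [q]
    · rw [hc]; rintro z rfl; simp [q]
    · rw [hc]; rintro z rfl; simp [q]
    · rw [hc]; rintro z rfl
      exact ⟨_, hq 0 (Nat.zero_le _), Or.inl rfl⟩
    · simp [RectilinearTree.length_point]
  | succ j ih =>
    have hjm : j < C.m := hj
    obtain ⟨T, hTq, hTp, hT0, hTy, hTx, hTh, hTl⟩ := ih hjm.le
    obtain ⟨T₁, hv₁, h0₁, hx₁, hc₁, hy₁, hl₁⟩ :=
      T.exists_addTooth (2 * ((j : ℝ) + 1)) hT0 hTy (C.lower j hjm)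
    obtain ⟨T₂, hv₂, h0₂, hx₂, hc₂, hy₂, hl₂⟩ :=
      T₁.exists_addTooth (-(2 * ((j : ℝ) + 1))) h0₁ hy₁ (C.upper j hjm)
    have hj0 : (0 : ℝ) ≤ 2 * ((j : ℝ) + 1) := by positivity
    have hj1 : -(2 * ((j : ℝ) + 1)) ≤ 0 := by linarith
    have hQ0 : C.q 0 ∈ Q := hq 0 (Nat.zero_le _)
    refine ⟨T₂, ?_, ?_, by exact_mod_cast h0₂, by exact_mod_cast hy₂, ?_, ?_, ?_⟩
    · intro i hi
      rcases Nat.le_succ_iff.1 hi with hi | rfl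
      · exact hv₂ _ (hv₁ _ (hTq i hi))
      · simpa [q] using hx₂
    · intro i hi
      rcases Nat.lt_succ_iff_lt_or_eq.1 hi with hi | rfl
      · exact hv₂ _ (hv₁ _ (hTp i hi))
      · exact hv₂ _ hx₁
    · intro z hz
      push_cast
      rcases hc₂ z hz with hz | hz | ⟨-, hz⟩
      · rcases hc₁ z hz with hz | hz | ⟨-, hz⟩
        · linarith [hTx z hz]
        · linarith
        · rw [uIcc_of_le hj0] at hz
          linarith [hz.1]
      · linarith
      · rw [uIcc_of_ge hj1] at hz
        exact hz.1
    · intro z hz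
      rcases hc₂ z hz with hz | hz | ⟨hz, -⟩
      · rcases hc₁ z hz with hz | hz | ⟨hz, -⟩
        · exact hTh hz
        · exact ⟨_, hQ0, Or.inl (by simpa [q] using hz)⟩
        · exact ⟨_, hp j hjm, Or.inr hz⟩
      · exact ⟨_, hQ0, Or.inl (by simpa [q] using hz)⟩
      · exact ⟨_, hq (j + 1) hj, Or.inr (by simpa [q] using hz)⟩
    · rw [hl₂, hl₁, hTl, abs_neg, abs_of_nonneg hj0]
      push_cast
      ring

/-- Because `η` is antitone the vertical parts of the staircase telescope, so visiting intermediate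
terminals is free. -/
theorem exists_tree (Q : Finset (ℝ × ℝ)) (η : ℕ → ℝ) (hη : Antitone η) (h0 : η 0 = C.g * C.m)
    (hq : ∀ j ≤ C.m, C.q j ∈ Q) (hp : ∀ j < C.m, C.p j ∈ Q) (r : ℕ)
    (hr : ∀ i ≤ r, (-C.M - 2 * i, η i) ∈ Q) :
    ∃ T : RectilinearTree, (∀ j ≤ C.m, C.q j ∈ T.verts) ∧ (∀ j < C.m, C.p j ∈ T.verts) ∧
      (∀ i ≤ r, (-C.M - 2 * i, η i) ∈ T.verts) ∧ (∀ z ∈ T.carrier, -C.M - 2 * r ≤ z.1) ∧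
      T.carrier ⊆ hananGrid Q ∧ T.length = C.g * C.m + 2 * (C.m * (C.m + 1)) +
        (C.M - 2 * C.m) + 2 * r + (C.g * C.m - η r) := by
  induction r with
  | zero =>
    obtain ⟨T, hTq, hTp, -, -, hTx, hTh, hTl⟩ := C.exists_trunk Q hq hp C.m le_rfl
    obtain ⟨T₁, hv₁, hx₁, hc₁, hy₁, hl₁⟩ :=
      T.exists_addStep (b := -C.M) (C.g * C.m) (hTq C.m le_rfl) hTx (by linarith [C.two_m_lt_M])
    refine ⟨T₁, fun j hj => hv₁ _ (hTq j hj), fun j hj => hv₁ _ (hTp j hj), ?_, ?_, ?_, ?_⟩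
    · intro i hi
      obtain rfl : i = 0 := by omega
      simpa [h0] using hx₁
    · simpa using hy₁
    · intro z hz
      rcases hc₁ z hz with hz | hz | hz
      · exact hTh hz
      · exact ⟨_, hq C.m le_rfl, Or.inr hz⟩
      · exact ⟨_, hr 0 le_rfl, Or.inl (by simpa using hz)⟩
    · rw [hl₁, hTl, h0]
      simp
      ring
  | succ r ih =>
    obtain ⟨T, hTq, hTp, hTr, hTx, hTh, hTl⟩ := ih fun i hi => hr i (by omega)
    obtain ⟨T₁, hv₁, hx₁, hc₁, hy₁, hl₁⟩ :=
      T.exists_addStep (b := -C.M - 2 * ((r : ℝ) + 1)) (η (r + 1)) (hTr r le_rfl) hTx (by linarith)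
    refine ⟨T₁, fun j hj => hv₁ _ (hTq j hj), fun j hj => hv₁ _ (hTp j hj), ?_, ?_, ?_, ?_⟩
    · intro i hi
      rcases Nat.le_succ_iff.1 hi with hi | rfl
      · exact hv₁ _ (hTr i hi)
      · simpa using hx₁
    · simpa using hy₁
    · intro z hz
      rcases hc₁ z hz with hz | hz | hz
      · exact hTh hz
      · exact ⟨_, hr r (by omega), Or.inr hz⟩
      · exact ⟨_, hr (r + 1) le_rfl, Or.inl (by simpa using hz)⟩
    · rw [hl₁, hTl, abs_of_nonneg (sub_nonneg.2 (hη (Nat.le_succ r)))]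
      push_cast
      ring

end Comb

/-! ### The point sets. -/

theorem IsSparse.of_spaced {δ : ℝ} {k : ℕ} (hk : 1 ≤ k) {A : Finset (ℝ × ℝ)}
    (hA : ∀ z ∈ A, ∀ w ∈ A, z ≠ w → 1 < |z.1 - w.1|) : IsSparse δ k A := by
  intro x
  refine le_trans ?_ hk
  rw [Set.ncard_le_one (A.finite_toSet.inter_of_left _)]
  rintro z ⟨hz, hzx⟩ w ⟨hw, hwx⟩
  by_contra hne
  have h1 := hA z hz w hw hne
  have h2 := hzx.1
  have h3 := hwx.1
  have : |z.1 - w.1| ≤ 1 := by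
    rw [abs_le]
    constructor <;> linarith [h2.1, h2.2, h3.1, h3.2]
  linarith

/-- The parameters of the construction: `m` right teeth on a trunk of length `δ`, each of which can
be placed at `N` heights, and a staircase with `r + 1` terminals. -/
structure Layout where
  δ : ℝ
  m : ℕ
  N : ℕ
  r : ℕ
  δ_pos : 0 < δ
  one_le_m : 1 ≤ m
  sq_le : m = 1 ∨ 25 * (m : ℝ) ^ 2 ≤ δ
  one_le_N : 1 ≤ N
  mul_le : m * N ≤ r

namespace Layout

variable (D : Layout)

/-- The distance between consecutive left teeth. -/
noncomputable def g : ℝ := D.δ / D.m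

/-- The distance of the staircase to the trunk. -/
noncomputable def M : ℝ := 2 * D.δ + 2 * (D.m * (D.m + 1)) + 1

/-- The candidate heights in increasing order. -/
noncomputable def height (i : ℕ) : ℝ :=
  -- The first quotient is rounded down, the second is exact. For `i = j * N + l` this is `g * j + g
  -- / 2 + g / 12 * (l / N)`, and in this form monotonicity is evident.
  11 / 12 * (D.g * (i / D.N : ℕ)) + D.g / 12 * (i / D.N : ℝ) + D.g / 2

/-- The heights of the terminals of the staircase. -/
noncomputable def stair (i : ℕ) : ℝ :=
  -- Candidates in reverse order, so that the stairs descend; surplus terminals at height 0 pad the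
  -- set to the prescribed size.
  if i = 0 then D.δ else if i ≤ D.m * D.N then D.height (D.m * D.N - i) else 0

theorem one_le_m' : (1 : ℝ) ≤ D.m := by exact_mod_cast D.one_le_m

theorem N_pos : (0 : ℝ) < D.N := by exact_mod_cast D.one_le_N

theorem g_pos : 0 < D.g := div_pos D.δ_pos (by linarith [D.one_le_m'])

theorem g_mul_m : D.g * D.m = D.δ := div_mul_cancel₀ _ (by linarith [D.one_le_m'])

theorem height_pos (i : ℕ) : 0 < D.height i := by
  have h1 := D.g_pos
  have h2 := D.N_pos
  unfold height
  positivity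

theorem height_mono : Monotone D.height := by
  intro i j hij
  have h1 := D.g_pos.le
  have h2 := D.N_pos.le
  have h3 : ((i / D.N : ℕ) : ℝ) ≤ (j / D.N : ℕ) := by exact_mod_cast Nat.div_le_div_right hij
  have h4 : (i : ℝ) ≤ j := by exact_mod_cast hij
  unfold height
  gcongr

theorem height_add (j l : ℕ) (hl : l < D.N) :
    D.height (j * D.N + l) = D.g * j + D.g / 2 + D.g / 12 * (l / D.N) := by
  have h1 : (j * D.N + l) / D.N = j := by
    rw [mul_comm, Nat.mul_add_div D.one_le_N, Nat.div_eq_of_lt hl, add_zero]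
  have h2 := D.N_pos.ne'
  unfold height
  rw [h1]
  push_cast
  field_simp
  ring

theorem frac_nonneg (l : ℕ) : 0 ≤ D.g / 12 * ((l : ℝ) / D.N) := by
  have h1 := D.g_pos.le
  have h2 := D.N_pos.le
  positivity

theorem frac_lt {l : ℕ} (hl : l < D.N) : D.g / 12 * ((l : ℝ) / D.N) < D.g / 12 := by
  have h1 : (l : ℝ) / D.N < 1 := (div_lt_one D.N_pos).2 (by exact_mod_cast hl)
  have := D.g_pos
  nlinarith

theorem height_lt {i : ℕ} (hi : i < D.m * D.N) : D.height i < D.δ := by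
  have hdiv : i / D.N < D.m := Nat.div_lt_of_lt_mul (by rwa [mul_comm])
  have hmod : i % D.N < D.N := Nat.mod_lt _ D.one_le_N
  have h1 := D.height_add (i / D.N) (i % D.N) hmod
  rw [Nat.div_add_mod'] at h1
  have h2 : ((i / D.N : ℕ) : ℝ) + 1 ≤ D.m := by exact_mod_cast hdiv
  have h3 := mul_le_mul_of_nonneg_left h2 D.g_pos.le
  rw [h1, ← D.g_mul_m]
  linarith [D.frac_lt hmod, D.g_pos]

theorem stair_zero : D.stair 0 = D.δ := if_pos rfl

theorem stair_sub {i : ℕ} (hi : i < D.m * D.N) : D.stair (D.m * D.N - i) = D.height i := by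
  unfold stair
  rw [if_neg (by omega), if_pos (by omega)]
  congr 1
  omega

theorem stair_nonneg (i : ℕ) : 0 ≤ D.stair i := by
  unfold stair
  split_ifs
  exacts [D.δ_pos.le, (D.height_pos _).le, le_rfl]

theorem stair_antitone : Antitone D.stair := by
  intro i j hij
  by_cases hj : j ≤ D.m * D.N
  · by_cases hj0 : j = 0
    · obtain rfl : i = j := by omega
      exact le_rfl
    by_cases hi0 : i = 0
    · unfold stair
      rw [if_pos hi0, if_neg hj0, if_pos hj]
      exact (D.height_lt (by omega)).le
    · unfold stair
      rw [if_neg hi0, if_neg hj0, if_pos hj, if_pos (by omega)]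
      exact D.height_mono (by omega)
  · have : D.stair j = 0 := by
      unfold stair
      rw [if_neg (by omega), if_neg hj]
    rw [this]
    exact D.stair_nonneg i

/-- The height of the right tooth `j` if the candidate `φ j` is selected. -/
noncomputable def toothHeight (φ : Fin D.m → Fin D.N) (j : ℕ) : ℝ :=
  D.g * j + D.g / 2 + D.g / 12 * ((if h : j < D.m then (φ ⟨j, h⟩ : ℕ) else 0 : ℕ) / D.N)

variable (φ : Fin D.m → Fin D.N)

theorem dite_lt (j : ℕ) : (if h : j < D.m then (φ ⟨j, h⟩ : ℕ) else 0) < D.N := by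
  split_ifs
  exacts [(φ _).2, D.one_le_N]

theorem toothHeight_lower (j : ℕ) : D.g * j + D.g / 2 ≤ D.toothHeight φ j := by
  unfold toothHeight
  linarith [D.frac_nonneg (if h : j < D.m then (φ ⟨j, h⟩ : ℕ) else 0)]

theorem toothHeight_upper (j : ℕ) : D.toothHeight φ j < D.g * (j + 1) - 5 / 12 * D.g := by
  unfold toothHeight
  linarith [D.frac_lt (D.dite_lt φ j)]

theorem toothHeight_eq_stair {j : ℕ} (hj : j < D.m) :
    ∃ i ≤ D.r, D.stair i = D.toothHeight φ j := by
  have hl := D.dite_lt φ j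
  set l := (if h : j < D.m then (φ ⟨j, h⟩ : ℕ) else 0) with hl'
  have h1 : j * D.N + l < D.m * D.N := by
    calc j * D.N + l < j * D.N + D.N := by omega
      _ = (j + 1) * D.N := by ring
      _ ≤ D.m * D.N := Nat.mul_le_mul_right _ hj
  refine ⟨D.m * D.N - (j * D.N + l), (Nat.sub_le _ _).trans D.mul_le, ?_⟩
  rw [D.stair_sub h1, D.height_add j l hl, toothHeight]

/-- The comb with the selected right teeth. -/
noncomputable def comb : Comb where
  m := D.m
  g := D.g
  M := D.M
  X := -D.M - 2 * D.r
  h := D.stair D.r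
  -- Exceeds `4 * m`, and `2 * e = 10 * m` fits below the margins `g / 2` and `5 / 12 * g` because
  -- `g ≥ 25 * m` when `m ≠ 1`.
  e := 5 * D.m
  y := D.toothHeight φ
  one_le_m := D.one_le_m
  lower := fun j _ => by linarith [D.toothHeight_lower φ j, D.g_pos]
  upper := fun j _ => by linarith [D.toothHeight_upper φ j, D.g_pos]
  e_gt := by linarith [D.one_le_m']
  gap := D.sq_le.imp id fun h j _ => by
    have h1 := D.one_le_m'
    have h2 : 25 * (D.m : ℝ) ≤ D.g := by
      unfold g
      rw [le_div_iff₀ (by linarith)]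
      nlinarith
    constructor
    · linarith [D.toothHeight_lower φ j]
    · linarith [D.toothHeight_upper φ j]
  h_nonneg := D.stair_nonneg _
  h_le := by
    rw [D.g_mul_m, ← D.stair_zero]
    exact D.stair_antitone (Nat.zero_le _)
  X_le := by
    have : (0 : ℝ) ≤ D.r := D.r.cast_nonneg
    linarith
  M_gt := by
    rw [D.g_mul_m, M]
    linarith

/-- A terminal of the staircase. -/
noncomputable def s (i : ℕ) : ℝ × ℝ := (-D.M - 2 * i, D.stair i)

/-- The end of a left tooth. -/
noncomputable def q (j : ℕ) : ℝ × ℝ := (-(2 * j), D.g * j)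

/-- The end of a right tooth. -/
noncomputable def p (j : ℕ) : ℝ × ℝ := (2 * (j + 1), D.toothHeight φ j)

open Classical in
/-- The points to the left of the separator. -/
noncomputable def left : Finset (ℝ × ℝ) :=
  (Finset.range (D.r + 1)).image D.s ∪ (Finset.range (D.m + 1)).image D.q

open Classical in
/-- The points to the right of the separator. -/
noncomputable def right : Finset (ℝ × ℝ) := (Finset.range D.m).image (D.p φ)

variable {D}

theorem mem_left {z : ℝ × ℝ} :
    z ∈ D.left ↔ (∃ i ≤ D.r, D.s i = z) ∨ ∃ j ≤ D.m, D.q j = z := by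
  simp [left]

variable {φ}

theorem mem_right {z : ℝ × ℝ} : z ∈ D.right φ ↔ ∃ j < D.m, D.p φ j = z := by
  simp [right]

theorem two_m_add_lt_M : 2 * (D.m : ℝ) + 1 < D.M := by
  unfold M
  nlinarith [D.δ_pos, D.one_le_m']

theorem one_lt_abs_of_ne {i j : ℕ} (h : i ≠ j) : 1 < |2 * (i : ℝ) - 2 * j| := by
  rcases lt_or_gt_of_ne h with h | h
  · have : (i : ℝ) + 1 ≤ j := by exact_mod_cast h
    rw [lt_abs]; right; linarith
  · have : (j : ℝ) + 1 ≤ i := by exact_mod_cast h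
    rw [lt_abs]; left; linarith

theorem s_fst_lt (i : ℕ) {j : ℕ} (hj : j ≤ D.m) : (D.s i).1 + 1 < (D.q j).1 := by
  have h1 : (j : ℝ) ≤ D.m := by exact_mod_cast hj
  have h2 : (0 : ℝ) ≤ i := i.cast_nonneg
  have h3 := D.two_m_add_lt_M
  simp only [s, q]
  linarith

theorem q_fst_le (j : ℕ) : (D.q j).1 ≤ 0 := by
  have h2 : (0 : ℝ) ≤ j := j.cast_nonneg
  simp only [q]
  linarith

theorem left_fst_le {z : ℝ × ℝ} (hz : z ∈ D.left) : z.1 ≤ 0 := by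
  rcases mem_left.1 hz with ⟨i, _, rfl⟩ | ⟨j, _, rfl⟩
  · have h1 := s_fst_lt (D := D) i (Nat.zero_le _)
    have h2 := q_fst_le (D := D) 0
    linarith
  · exact q_fst_le j

theorem two_le_right_fst {z : ℝ × ℝ} (hz : z ∈ D.right φ) : 2 ≤ z.1 := by
  obtain ⟨j, _, rfl⟩ := mem_right.1 hz
  have h2 : (0 : ℝ) ≤ j := j.cast_nonneg
  simp only [p]
  linarith

theorem left_spaced : ∀ z ∈ D.left, ∀ w ∈ D.left, z ≠ w → 1 < |z.1 - w.1| := by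
  intro z hz w hw hne
  rcases mem_left.1 hz with ⟨i, hi, rfl⟩ | ⟨i, hi, rfl⟩ <;>
    rcases mem_left.1 hw with ⟨j, hj, rfl⟩ | ⟨j, hj, rfl⟩
  · have := one_lt_abs_of_ne (i := i) (j := j) (by rintro rfl; exact hne rfl)
    rw [abs_sub_comm] at this
    convert this using 2
    simp only [s]; ring
  · rw [lt_abs]; right; linarith [s_fst_lt i hj]
  · rw [lt_abs]; left; linarith [s_fst_lt j hi]
  · have := one_lt_abs_of_ne (i := i) (j := j) (by rintro rfl; exact hne rfl)
    rw [abs_sub_comm] at this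
    convert this using 2
    simp only [q]; ring

theorem right_spaced : ∀ z ∈ D.right φ, ∀ w ∈ D.right φ, z ≠ w → 1 < |z.1 - w.1| := by
  intro z hz w hw hne
  obtain ⟨i, hi, rfl⟩ := mem_right.1 hz
  obtain ⟨j, hj, rfl⟩ := mem_right.1 hw
  have := one_lt_abs_of_ne (i := i) (j := j) (by rintro rfl; exact hne rfl)
  convert this using 2
  simp only [p]; ring

theorem union_spaced [DecidableEq (ℝ × ℝ)] :
    ∀ z ∈ D.left ∪ D.right φ, ∀ w ∈ D.left ∪ D.right φ, z ≠ w → 1 < |z.1 - w.1| := by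
  intro z hz w hw hne
  rcases Finset.mem_union.1 hz with hz | hz <;> rcases Finset.mem_union.1 hw with hw | hw
  · exact left_spaced z hz w hw hne
  · rw [lt_abs]; right; linarith [left_fst_le hz, two_le_right_fst hw]
  · rw [lt_abs]; left; linarith [left_fst_le hw, two_le_right_fst hz]
  · exact right_spaced z hz w hw hne

theorem left_inStrip : InStrip D.δ D.left := by
  intro z hz
  rcases mem_left.1 hz with ⟨i, hi, rfl⟩ | ⟨j, hj, rfl⟩
  · exact ⟨D.stair_nonneg i, D.stair_zero ▸ D.stair_antitone (Nat.zero_le i)⟩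
  · have h1 : (j : ℝ) ≤ D.m := by exact_mod_cast hj
    refine ⟨mul_nonneg D.g_pos.le j.cast_nonneg, ?_⟩
    rw [← D.g_mul_m]
    exact mul_le_mul_of_nonneg_left h1 D.g_pos.le

theorem exists_left_snd_eq {z : ℝ × ℝ} (hz : z ∈ D.right φ) : ∃ w ∈ D.left, w.2 = z.2 := by
  obtain ⟨j, hj, rfl⟩ := mem_right.1 hz
  obtain ⟨i, hi, h⟩ := D.toothHeight_eq_stair φ hj
  exact ⟨D.s i, mem_left.2 (Or.inl ⟨i, hi, rfl⟩), h⟩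

theorem right_inStrip : InStrip D.δ (D.right φ) := by
  intro z hz
  obtain ⟨w, hw, h⟩ := exists_left_snd_eq hz
  rw [← h]
  exact left_inStrip w hw

theorem card_left : D.left.card = D.r + 1 + (D.m + 1) := by
  classical
  rw [left, Finset.card_union_of_disjoint, Finset.card_image_of_injective,
    Finset.card_image_of_injective, Finset.card_range, Finset.card_range]
  · intro i j hij
    have := congrArg Prod.fst hij
    simpa [q] using this
  · intro i j hij
    have := congrArg Prod.fst hij
    simpa [s] using this
  · refine Finset.disjoint_left.2 fun z hz hz' => ?_
    obtain ⟨i, -, rfl⟩ := Finset.mem_image.1 hz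
    obtain ⟨j, hj, h⟩ := Finset.mem_image.1 hz'
    have := s_fst_lt (D := D) i (Nat.lt_succ_iff.1 (Finset.mem_range.1 hj))
    rw [h] at this
    linarith

theorem card_right : (D.right φ).card = D.m := by
  classical
  rw [right, Finset.card_image_of_injective, Finset.card_range]
  intro i j hij
  have := congrArg Prod.fst hij
  simpa [p] using this

/-- Different teeth have disjoint height ranges, so a height reveals both its tooth and the selected
candidate. -/
theorem toothHeight_eq_iff {ψ : Fin D.m → Fin D.N} {i j : ℕ} (hi : i < D.m)
    (h : D.toothHeight φ i = D.toothHeight ψ j) : ∃ hj : i = j, φ ⟨i, hi⟩ = ψ ⟨j, hj ▸ hi⟩ := by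
  have hg := D.g_pos
  have h1 := D.toothHeight_lower φ i
  have h2 := D.toothHeight_upper φ i
  have h3 := D.toothHeight_lower ψ j
  have h4 := D.toothHeight_upper ψ j
  have hij : i = j := by
    by_contra hne
    rcases lt_or_gt_of_ne hne with hlt | hlt
    · have : (i : ℝ) + 1 ≤ j := by exact_mod_cast hlt
      have := mul_le_mul_of_nonneg_left this hg.le
      linarith
    · have : (j : ℝ) + 1 ≤ i := by exact_mod_cast hlt
      have := mul_le_mul_of_nonneg_left this hg.le
      linarith
  subst hij
  refine ⟨rfl, Fin.ext ?_⟩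
  have hN := D.N_pos.ne'
  simpa [toothHeight, hi, hg.ne', div_left_inj' hN] using h

theorem right_injective : Function.Injective D.right := by
  intro φ ψ h
  funext ⟨i, hi⟩
  have h1 : D.p φ i ∈ D.right ψ := h ▸ mem_right.2 ⟨i, hi, rfl⟩
  obtain ⟨j, hj, hji⟩ := mem_right.1 h1
  obtain ⟨rfl, h2⟩ := toothHeight_eq_iff hi (congrArg Prod.snd hji).symm
  exact h2

/-- The crossing pattern that belongs to a set of points to the right of the separator: all its
points have a horizontal connection to the separator, and these are connected on the left. -/
def pattern (P : Finset (ℝ × ℝ)) : Set (Set (ℝ × ℝ)) :=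
  {(fun z : ℝ × ℝ => ((1 : ℝ), z.2)) '' P}

theorem pattern_right : pattern (D.right φ) =
    {(fun j => ((1 : ℝ), D.toothHeight φ j)) '' {j | j < D.m}} := by
  unfold pattern
  congr 1
  ext z
  constructor
  · rintro ⟨w, hw, rfl⟩
    obtain ⟨j, hj, rfl⟩ := mem_right.1 hw
    exact ⟨j, hj, rfl⟩
  · rintro ⟨j, hj, rfl⟩
    exact ⟨D.p φ j, mem_right.2 ⟨j, hj, rfl⟩, rfl⟩

theorem pattern_injective {ψ : Fin D.m → Fin D.N}
    (h : pattern (D.right φ) = pattern (D.right ψ)) : φ = ψ := by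
  rw [pattern_right, pattern_right, Set.singleton_eq_singleton_iff] at h
  funext ⟨i, hi⟩
  have h1 : ((1 : ℝ), D.toothHeight φ i) ∈
      (fun j => ((1 : ℝ), D.toothHeight ψ j)) '' {j | j < D.m} := h ▸ ⟨i, hi, rfl⟩
  obtain ⟨j, hj, hji⟩ := h1
  obtain ⟨rfl, h2⟩ := toothHeight_eq_iff hi (congrArg Prod.snd hji).symm
  exact h2

section Union

variable [DecidableEq (ℝ × ℝ)]

theorem isSeparator : IsSeparator (D.left ∪ D.right φ) (D.r + 1 + (D.m + 1)) 1 := by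
  classical
  refine ⟨D.q 0, Finset.mem_union_left _ (mem_left.2 (Or.inr ⟨0, Nat.zero_le _, rfl⟩)), D.p φ 0,
    Finset.mem_union_right _ (mem_right.2 ⟨0, D.one_le_m, rfl⟩), by simp [q, p], ?_, ?_,
    by simp [q, p]⟩
  · intro z hz
    rcases Finset.mem_union.1 hz with hz | hz
    · left; simpa [q] using left_fst_le hz
    · right; simpa [p] using two_le_right_fst hz
  · rw [← card_left]
    congr 1
    ext z
    simp only [Finset.mem_filter, Finset.mem_union]
    constructor
    · rintro ⟨hz | hz, h⟩
      · exact hz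
      · have := two_le_right_fst hz
        simp only [q, Nat.cast_zero, mul_zero, neg_zero] at h
        linarith
    · intro hz
      exact ⟨Or.inl hz, by simpa [q] using left_fst_le hz⟩

/-- Vertical lines through right points miss x = 1, and their horizontal lines already pass through
staircase terminals. -/
theorem gridCrossings_union :
    gridCrossings (D.left ∪ D.right φ) 1 = gridCrossings D.left 1 := by
  ext z
  constructor
  · rintro ⟨⟨w, hw, h⟩, hz⟩
    refine ⟨?_, hz⟩
    rcases Finset.mem_union.1 hw with hw | hw
    · exact ⟨w, hw, h⟩
    · rcases h with h | h
      · have h1 := two_le_right_fst hw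
        have h2 : z.1 = 1 := hz
        linarith
      · obtain ⟨x, hx, hxw⟩ := exists_left_snd_eq hw
        exact ⟨x, hx, Or.inr (h.trans hxw.symm)⟩
  · rintro ⟨⟨w, hw, h⟩, hz⟩
    exact ⟨⟨w, Finset.mem_union_left _ hw, h⟩, hz⟩

theorem spans {T : RectilinearTree} (hT : T.IsSteinerTree (D.left ∪ D.right φ)) :
    (D.comb φ).Spans (T.verts : Set (ℝ × ℝ)) where
  q_mem := fun j hj => hT (Finset.mem_union_left _ (mem_left.2 (Or.inr ⟨j, hj, rfl⟩)))
  p_mem := fun j hj => hT (Finset.mem_union_right _ (mem_right.2 ⟨j, hj, rfl⟩))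
  low_mem := hT (Finset.mem_union_left _ (mem_left.2 (Or.inl ⟨D.r, le_rfl, rfl⟩)))
  high_mem := hT (Finset.mem_union_left _ (mem_left.2 (Or.inl ⟨0, Nat.zero_le _, by
    simp [s, stair_zero, comb, g_mul_m]⟩)))

theorem exists_tree : ∃ T : RectilinearTree, T.IsSteinerTree (D.left ∪ D.right φ) ∧
    T.carrier ⊆ hananGrid (D.left ∪ D.right φ) ∧ T.length = (D.comb φ).optLength := by
  obtain ⟨T, hq, hp, hs, -, hT, hl⟩ := (D.comb φ).exists_tree (D.left ∪ D.right φ) D.stair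
    D.stair_antitone (D.stair_zero.trans D.g_mul_m.symm)
    (fun j hj => Finset.mem_union_left _ (mem_left.2 (Or.inr ⟨j, hj, rfl⟩)))
    (fun j hj => Finset.mem_union_right _ (mem_right.2 ⟨j, hj, rfl⟩)) D.r
    (fun i hi => Finset.mem_union_left _ (mem_left.2 (Or.inl ⟨i, hi, rfl⟩)))
  refine ⟨T, fun z hz => ?_, hT, ?_⟩
  · rcases Finset.mem_union.1 hz with hz | hz
    · rcases mem_left.1 hz with ⟨i, hi, rfl⟩ | ⟨j, hj, rfl⟩
      · exact hs i hi
      · exact hq j hj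
    · obtain ⟨j, hj, rfl⟩ := mem_right.1 hz
      exact hp j hj
  · rw [hl, Comb.optLength]
    simp only [comb]
    ring

/-- The lower bound holds for all Steiner trees, on the Hanan grid or not, and the explicit comb on
the grid attains it. -/
theorem isMRST_iff {T : RectilinearTree} : IsMRST (D.left ∪ D.right φ) T ↔
    T.IsSteinerTree (D.left ∪ D.right φ) ∧ T.carrier ⊆ hananGrid (D.left ∪ D.right φ) ∧
      T.length = (D.comb φ).optLength := by
  constructor
  · rintro ⟨h1, h2, h3⟩
    obtain ⟨T', h1', h2', h3'⟩ := exists_tree (D := D) (φ := φ)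
    exact ⟨h1, h2, le_antisymm (h3' ▸ h3 T' h1' h2')
      (Comb.optLength_le_length (spans h1).carrier)⟩
  · rintro ⟨h1, h2, h3⟩
    exact ⟨h1, h2, fun T' h1' _ => h3 ▸ Comb.optLength_le_length (spans h1').carrier⟩

theorem crossingPattern_eq {T : RectilinearTree} (hT : IsMRST (D.left ∪ D.right φ) T) :
    crossingPattern T 1 = pattern (D.right φ) := by
  obtain ⟨h1, -, h3⟩ := isMRST_iff.1 hT
  rw [pattern_right]
  exact Comb.crossingPattern_eq_of_length_eq (spans h1) h3

theorem isViable {k : ℕ} (hm : (D.m : ℝ) ≤ Real.sqrt D.δ) :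
    IsViable D.δ k (D.left ∪ D.right φ) 1 (pattern (D.right φ)) := by
  refine ⟨?_, Set.pairwiseDisjoint_singleton _ _, ?_, ?_, ?_, ?_⟩
  · rintro B rfl
    exact ⟨_, D.p φ 0, mem_right.2 ⟨0, D.one_le_m, rfl⟩, rfl⟩
  · rw [pattern, Set.sUnion_singleton]
    rintro _ ⟨z, hz, rfl⟩
    exact ⟨⟨z, Finset.mem_union_right _ hz, Or.inr rfl⟩, rfl⟩
  · rw [pattern, Set.sUnion_singleton]
    exact (D.right φ).finite_toSet.image _
  · rw [pattern, Set.sUnion_singleton]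
    have h1 : ((fun z : ℝ × ℝ => ((1 : ℝ), z.2)) '' (D.right φ : Set (ℝ × ℝ))).ncard ≤ D.m := by
      refine (Set.ncard_image_le (D.right φ).finite_toSet).trans ?_
      rw [Set.ncard_coe_finset, card_right]
    have h2 : (((fun z : ℝ × ℝ => ((1 : ℝ), z.2)) '' (D.right φ : Set (ℝ × ℝ))).ncard : ℝ) ≤ D.m := by
      exact_mod_cast h1
    have h3 : (0 : ℝ) ≤ k := k.cast_nonneg
    have h4 := Real.sqrt_nonneg D.δ
    nlinarith
  · rintro B rfl B' rfl h
    exact absurd rfl h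

end Union

end Layout

/-! ### Choice of parameters and the final count. -/

/-- The number of right teeth in a strip of height `δ`. -/
noncomputable def toothCount (δ : ℝ) : ℕ := max 1 ⌊Real.sqrt δ / 5⌋₊

theorem one_le_toothCount (δ : ℝ) : 1 ≤ toothCount δ := le_max_left _ _

theorem toothCount_le {δ : ℝ} (hδ : 1 ≤ δ) : (toothCount δ : ℝ) ≤ Real.sqrt δ := by
  have h1 : 1 ≤ Real.sqrt δ := Real.one_le_sqrt.2 hδ
  have h2 := Nat.floor_le (show 0 ≤ Real.sqrt δ / 5 by positivity)
  unfold toothCount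
  push_cast
  exact max_le h1 (by linarith)

theorem sqrt_le_toothCount (δ : ℝ) : 1 / 10 * Real.sqrt δ ≤ toothCount δ := by
  have h1 := Nat.lt_floor_add_one (Real.sqrt δ / 5)
  have h2 : (⌊Real.sqrt δ / 5⌋₊ : ℝ) ≤ toothCount δ := by exact_mod_cast le_max_right _ _
  have h3 : (1 : ℝ) ≤ toothCount δ := by exact_mod_cast one_le_toothCount δ
  linarith

theorem toothCount_sq_le {δ : ℝ} (hδ : 1 ≤ δ) :
    toothCount δ = 1 ∨ 25 * (toothCount δ : ℝ) ^ 2 ≤ δ := by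
  rcases max_choice 1 ⌊Real.sqrt δ / 5⌋₊ with h | h
  · exact Or.inl h
  · right
    have h2 := Nat.floor_le (show 0 ≤ Real.sqrt δ / 5 by positivity)
    have h3 : (toothCount δ : ℝ) ≤ Real.sqrt δ / 5 := by
      unfold toothCount
      rwa [h]
    have h4 := Real.sq_sqrt (show 0 ≤ δ by linarith)
    have h5 : (0 : ℝ) ≤ toothCount δ := Nat.cast_nonneg _
    nlinarith

/-- Everything follows from `n ≤ 4 * m * N ≤ n ^ 2`, raised to the power `m`; the factor `(4 * m) ^
m` depends on `δ` only. -/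
theorem pow_bounds {n m N : ℕ} (hm : 1 ≤ m) (hn : 2 ≤ n) (h1 : n ≤ 4 * m * N)
    (h2 : 2 * (m * N) ≤ n) {a : ℝ} (ha : 1 / 10 * a ≤ m) (ha' : (m : ℝ) ≤ a) :
    ((4 * m : ℝ) ^ m)⁻¹ * (n : ℝ) ^ (1 / 10 * a) ≤ ((N ^ m : ℕ) : ℝ) ∧
      ((N ^ m : ℕ) : ℝ) ≤ ((4 * m : ℝ) ^ m)⁻¹ * (n : ℝ) ^ (2 * a) := by
  have hm' : (1 : ℝ) ≤ m := by exact_mod_cast hm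
  have hn' : (2 : ℝ) ≤ n := by exact_mod_cast hn
  have h1' : (n : ℝ) ≤ 4 * m * N := by exact_mod_cast h1
  have h2' : 2 * ((m : ℝ) * N) ≤ n := by exact_mod_cast h2
  have hpos : (0 : ℝ) < (4 * m : ℝ) ^ m := by positivity
  push_cast
  rw [inv_mul_le_iff₀ hpos, le_inv_mul_iff₀ hpos, ← mul_pow]
  constructor
  · calc (n : ℝ) ^ (1 / 10 * a) ≤ (n : ℝ) ^ (m : ℝ) :=
        Real.rpow_le_rpow_of_exponent_le (by linarith) ha
      _ = (n : ℝ) ^ m := Real.rpow_natCast _ _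
      _ ≤ (4 * m * N : ℝ) ^ m := by gcongr
  · calc (4 * m * N : ℝ) ^ m ≤ ((n : ℝ) ^ 2) ^ m := by
          gcongr
          nlinarith
      _ = (n : ℝ) ^ ((2 * m : ℕ) : ℝ) := by rw [Real.rpow_natCast, pow_mul]
      _ ≤ (n : ℝ) ^ (2 * a) :=
        Real.rpow_le_rpow_of_exponent_le (by linarith) (by push_cast; linarith)

theorem mainTheorem8 (k : ℕ) (hk : 1 ≤ k) :
    ∃ (c₁ c₂ C : ℝ) (f : ℝ → ℝ), 0 < c₁ ∧ 0 < c₂ ∧ 0 < C ∧ (∀ δ : ℝ, 1 ≤ δ → 0 < f δ) ∧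
      ∀ (δ : ℝ) (n : ℕ), 1 ≤ δ → C * Real.sqrt δ ≤ n →
        ∃ (Pleft : Finset (ℝ × ℝ)) (Pright : Finset (Finset (ℝ × ℝ))) (s : ℝ)
          (X : Finset (ℝ × ℝ) → Set (Set (ℝ × ℝ))),
          Pleft.card = n / 2 ∧ InStrip δ Pleft ∧ IsSparse δ k Pleft ∧
          f δ * (n : ℝ) ^ (c₁ * Real.sqrt δ) ≤ (Pright.card : ℝ) ∧
          (Pright.card : ℝ) ≤ f δ * (n : ℝ) ^ (c₂ * Real.sqrt δ) ∧
          (∀ P ∈ Pright,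
            c₁ * Real.sqrt δ ≤ (P.card : ℝ) ∧ (P.card : ℝ) ≤ c₂ * Real.sqrt δ ∧
            InStrip δ P ∧ IsSparse δ k P ∧ IsSparse δ k (Pleft ∪ P) ∧
            (∀ a ∈ Pleft, ∀ b ∈ P, a.1 < b.1) ∧
            IsSeparator (Pleft ∪ P) (n / 2) s ∧
            gridCrossings (Pleft ∪ P) s = gridCrossings Pleft s ∧
            (∃ T, IsMRST (Pleft ∪ P) T) ∧
            (∀ T, IsMRST (Pleft ∪ P) T → crossingPattern T s = X P) ∧
            IsViable δ k (Pleft ∪ P) s (X P)) ∧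
          (∀ P ∈ Pright, ∀ P' ∈ Pright, P ≠ P' → X P ≠ X P') := by
  classical
  -- The tooth count lies between `√δ / 10` and `√δ`. The exponent 2 absorbs `4 * m * N ≤ n ^ 2`,
  -- and 20 ensures `n ≥ 20 * m`, enough for `N ≥ 1` and `n ≤ 4 * m * N`.
  refine ⟨1 / 10, 2, 20, fun δ => ((4 * toothCount δ : ℝ) ^ toothCount δ)⁻¹, by norm_num,
    by norm_num, by norm_num, fun δ _ => ?_, fun δ n hδ hn => ?_⟩
  · have : 0 < toothCount δ := one_le_toothCount δ
    positivity
  have hmle := toothCount_le hδ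
  have hlem := sqrt_le_toothCount δ
  have hsq := toothCount_sq_le hδ
  have hm := one_le_toothCount δ
  simp only
  set m := toothCount δ
  have hnm : 20 * m ≤ n := by
    have : (20 * m : ℝ) ≤ n := by linarith
    exact_mod_cast this
  -- The left set has `r + 1` staircase terminals and `m + 1` left tooth ends, together `n / 2`.
  set r := n / 2 - m - 2 with hr
  set N := r / m with hN
  have hmN : m * N ≤ r := Nat.mul_div_le r m
  have hrN : r < m * N + m := by
    have := Nat.lt_mul_div_succ r hm
    rwa [mul_add, mul_one] at this
  have hN1 : 1 ≤ N := (Nat.one_le_div_iff hm).2 (by omega)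
  let D : Layout := ⟨δ, m, N, r, by linarith, hm, hsq, hN1, hmN⟩
  have hhalf : n / 2 = D.r + 1 + (D.m + 1) := by
    change n / 2 = r + 1 + (m + 1)
    omega
  obtain ⟨hlow, hup⟩ := pow_bounds (n := n) (m := m) (N := N) hm (by omega)
    (by rw [mul_assoc]; omega) (by omega) hlem hmle
  have hcard : (Finset.univ.image D.right).card = N ^ m := by
    rw [Finset.card_image_of_injective _ Layout.right_injective, Finset.card_univ]
    simp [D]
  refine ⟨D.left, Finset.univ.image D.right, 1, Layout.pattern, ?_, Layout.left_inStrip,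
    .of_spaced hk Layout.left_spaced, by rwa [hcard], by rwa [hcard], ?_, ?_⟩
  · rw [hhalf, Layout.card_left]
  · intro P hP
    obtain ⟨φ, -, rfl⟩ := Finset.mem_image.1 hP
    obtain ⟨T, hT⟩ := Layout.exists_tree (D := D) (φ := φ)
    refine ⟨?_, ?_, Layout.right_inStrip, .of_spaced hk Layout.right_spaced,
      .of_spaced hk Layout.union_spaced, ?_, ?_, Layout.gridCrossings_union,
      ⟨T, Layout.isMRST_iff.2 hT⟩, fun T hT => Layout.crossingPattern_eq hT,
      Layout.isViable hmle⟩
    · rw [Layout.card_right]; exact hlem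
    · rw [Layout.card_right]
      have : (D.m : ℝ) ≤ Real.sqrt δ := hmle
      linarith [Real.sqrt_nonneg δ]
    · intro a ha b hb
      linarith [Layout.left_fst_le ha, Layout.two_le_right_fst hb]
    · rw [hhalf]; exact Layout.isSeparator
  · intro P hP P' hP' hne h
    obtain ⟨φ, -, rfl⟩ := Finset.mem_image.1 hP
    obtain ⟨ψ, -, rfl⟩ := Finset.mem_image.1 hP'
    exact hne (congrArg D.right (Layout.pattern_injective h))
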